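/- Literals are variables $v$ and their complements $\overline v$ (with $\overline{\overline v}=v$). A clause is a finite set of literals not containing both a literal and its complement, and a clause-set is a finite set of clauses. For a clause-set $F$ let $u(F)$ be the number of its unit-clauses (clauses with exactly one literal) and let $\ell(F)=\sum_{C\in F}|C|$. A minimally unsatisfiable subset (MUS) of $F$ is an unsatisfiable $F'\subseteq F$ such that $F'\setminus\{C\}$ is satisfiable for every $C\in F'$. Let $\mathcal P$ be the class of clause-sets $F$ all of whose clauses have one or two literals (2-CNFs without the empty clause). For literals $x,y$ we write $x\to\dots\to y$ for the set of clauses $\{\overline{a_i},a_{i+1}\}$, $0\le i<m$, of a chain $x=a_0,a_1,\dots,a_m=y$ of literals with $m\ge 1$, where neighbours in the chain have different variables and where the variables of internal literals are different from each other, from the variables of all endpoints of chains, and from those of internal literals of other chains in the same formula. Let $x,y$ be literals with different variables. A clause-set belongs to Family I if it is of the form $\{\{x\},\{\overline x\}\}$, or consists of $\{x\}$, $\{y\}$ and a chain $x\to\dots\to\overline y$. It belongs to Family II if it consists of $\{x\}$ and a chain $x\to\dots\to\overline x$, or of $\{x\}$ and chains $x\to\dots\to y$ and $y\to\dots\to\overline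 y$. Time is measured in the usual random-access model: a machine with registers and indirectly addressed memory, initially zero outside the input, with unit cost for constants, addition, truncated subtraction, halving, comparison and memory access, where all numbers written have $O(\log N)$ bits, $N$ being the number of input words plus the largest input word plus one. The input is $F$, given as an arbitrary list, without repetition, of its clauses, each clause being given as an arbitrary list, without repetition, of its literals, with variables and literals represented by natural numbers. A bound $O(T(F))$ is read as $O(\ell(F)+1)$, i.e. linear time, for those $F$ with $T(F)=0$. **Corollary.** 1. For $F\in\mathcal P$, an MUS $F'$ of $F$ contains at least one unit-clause if and only if it belongs to Family I or II, and it contains exactly one unit-clause if and only if it belongs to Family II. 2. Whether $F\in\mathcal P$ has an MUS containing at least one unit-clause (that is, an MUS belonging to Family I or II) can be decided in time $O(u(F)\,\ell(F))$, and thus in quadratic time $O(\ell(F)^2)$, where in the positive case such an MUS is also computed within the same time bound. 3. The same holds for MUSs with exactly one unit-clause (that is, belonging to Family II): whether $F\in\mathcal P$ has such an MUS can be decided, and one can be found in the positive case, in time $O(u(F)\,\ell(F))$, and thus in quadratic time $O(\ell(F)^2)$. -/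

import Mathlib

namespace TwoCNF

/-! ### Clause-sets -/

/-- A literal: a variable (a natural number) with a sign (`true` for the positive literal). -/
abbrev Lit := ℕ × Bool

/-- The complement of a literal. -/
def Lit.compl (x : Lit) : Lit := (x.1, !x.2)

abbrev Clause := Finset Lit

abbrev CNF := Finset Clause

/-- A clause does not contain a literal together with its complement. -/
def Clashfree (C : Clause) : Prop := ∀ x ∈ C, Lit.compl x ∉ C

def IsClauseSet (F : CNF) : Prop := ∀ C ∈ F, Clashfree C

/-- 2-CNFs without the empty clause. -/
def IsTwoCNF (F : CNF) : Prop :=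
  IsClauseSet F ∧ (∀ C ∈ F, C.card ≤ 2) ∧ (∅ : Clause) ∉ F

/-- A partial assignment `φ` satisfies `F` if it makes a literal of every clause true; `none`
means that the variable is not in the domain of `φ`. -/
def Satisfies (φ : ℕ → Option Bool) (F : CNF) : Prop :=
  ∀ C ∈ F, ∃ x ∈ C, φ x.1 = some x.2

def Satisfiable (F : CNF) : Prop := ∃ φ : ℕ → Option Bool, Satisfies φ F

/-- Minimally unsatisfiable clause-sets. -/
def IsMU (F : CNF) : Prop :=
  IsClauseSet F ∧ ¬ Satisfiable F ∧ ∀ C ∈ F, Satisfiable (F.erase C)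

/-- `F'` is a minimally unsatisfiable subset (MUS) of `F`. -/
def IsMUS (F' F : CNF) : Prop := F' ⊆ F ∧ IsMU F'

/-- The number of unit-clauses. -/
def unitCount (F : CNF) : ℕ := (F.filter fun C => C.card = 1).card

/-- The formula size: the number of literal occurrences. -/
def size (F : CNF) : ℕ := ∑ C ∈ F, C.card

/-! ### The Families I and II -/

/-- The clauses `{¬a, b}` of the implications `a → b` between neighbours of a list. -/
def chainClauses : List Lit → CNF
  | a :: b :: r => insert {Lit.compl a, b} (chainClauses (b :: r))
  | _ => ∅

/-- The underlying variables of the literals in the list are pairwise different. -/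
def DistinctVars (p : List Lit) : Prop := (p.map Prod.fst).Nodup

/-- Family I: `{x}, {¬x}`, or `{x}, {y}` together with a chain `x → ... → ¬y`. -/
def FamilyI (F : CNF) : Prop :=
  (∃ x : Lit, F = {{x}, {Lit.compl x}}) ∨
  (∃ (x y : Lit) (zs : List Lit), DistinctVars (x :: zs ++ [y]) ∧
    F = {{x}, {y}} ∪ chainClauses (x :: zs ++ [Lit.compl y]))

/-- Family II: `{x}` together with a chain `x → ... → ¬x`, or with chains
`x → ... → y → ... → ¬y`. -/
def FamilyII (F : CNF) : Prop :=
  (∃ (x : Lit) (zs : List Lit), zs ≠ [] ∧ DistinctVars (x :: zs) ∧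
    F = {{x}} ∪ chainClauses (x :: zs ++ [Lit.compl x])) ∨
  (∃ (x y : Lit) (zs ws : List Lit), ws ≠ [] ∧ DistinctVars (x :: zs ++ y :: ws) ∧
    F = {{x}} ∪ chainClauses (x :: zs ++ y :: ws ++ [Lit.compl y]))

/-! ### Random-access machines

A program works on registers (a program names only finitely many of them) and on an
indirectly addressable memory, all holding natural numbers. Programs are structured
(sequence, branching, loop), which is, up to a constant factor in the running time, the same
as a list of instructions with jumps. -/

structure State where
  reg : ℕ → ℕ
  mem : ℕ → ℕ

def State.setReg (s : State) (i v : ℕ) : State := ⟨Function.update s.reg i v, s.mem⟩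

def State.setMem (s : State) (a v : ℕ) : State := ⟨s.reg, Function.update s.mem a v⟩

/-- Expressions: constants, registers, addition, truncated subtraction, halving (rounding
down), and reading the memory cell at a computed address. -/
inductive RExpr where
  | const (n : ℕ)
  | reg (i : ℕ)
  | add (e f : RExpr)
  | sub (e f : RExpr)
  | half (e : RExpr)
  | load (e : RExpr)

def RExpr.eval (s : State) : RExpr → ℕ
  | .const n => n
  | .reg i => s.reg i
  | .add e f => e.eval s + f.eval s
  | .sub e f => e.eval s - f.eval s
  | .half e => e.eval s / 2
  | .load e => s.mem (e.eval s)

/-- Every constant, register access, arithmetic operation and memory access costs one step. -/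
def RExpr.cost : RExpr → ℕ
  | .const _ => 1
  | .reg _ => 1
  | .add e f => e.cost + f.cost + 1
  | .sub e f => e.cost + f.cost + 1
  | .half e => e.cost + 1
  | .load e => e.cost + 1

/-- Tests: the comparisons `e < f` and `e = f`. -/
inductive Test where
  | lt (e f : RExpr)
  | eq (e f : RExpr)

def Test.Holds (s : State) : Test → Prop
  | .lt e f => e.eval s < f.eval s
  | .eq e f => e.eval s = f.eval s

def Test.cost : Test → ℕ
  | .lt e f => e.cost + f.cost + 1
  | .eq e f => e.cost + f.cost + 1

inductive Program where
  | skip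
  | assign (i : ℕ) (e : RExpr)
  | store (a e : RExpr)
  | seq (p q : Program)
  | branch (b : Test) (p q : Program)
  | loop (b : Test) (p : Program)

/-- `Exec W p s t s'`: started in the state `s`, the program `p` halts after `t` steps in the
state `s'`, where every number that is written to a register or to the memory, and every
address that is written to, is at most `W`. (An attempt to exceed `W` leaves the program
without a result.) -/
inductive Exec (W : ℕ) : Program → State → ℕ → State → Prop
  | skip (s : State) : Exec W .skip s 1 s
  | assign (i : ℕ) (e : RExpr) (s : State) (h : e.eval s ≤ W) :
      Exec W (.assign i e) s (e.cost + 1) (s.setReg i (e.eval s))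
  | store (a e : RExpr) (s : State) (ha : a.eval s ≤ W) (he : e.eval s ≤ W) :
      Exec W (.store a e) s (a.cost + e.cost + 1) (s.setMem (a.eval s) (e.eval s))
  | seq {p q : Program} {s s' s'' : State} {t t' : ℕ} (hp : Exec W p s t s')
      (hq : Exec W q s' t' s'') : Exec W (.seq p q) s (t + t') s''
  | branch_pos {b : Test} {p q : Program} {s s' : State} {t : ℕ} (hb : b.Holds s)
      (hp : Exec W p s t s') : Exec W (.branch b p q) s (b.cost + 1 + t) s'
  | branch_neg {b : Test} {p q : Program} {s s' : State} {t : ℕ} (hb : ¬ b.Holds s)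
      (hq : Exec W q s t s') : Exec W (.branch b p q) s (b.cost + 1 + t) s'
  | loop_pos {b : Test} {p : Program} {s s' s'' : State} {t t' : ℕ} (hb : b.Holds s)
      (hp : Exec W p s t s') (hl : Exec W (.loop b p) s' t' s'') :
      Exec W (.loop b p) s (b.cost + 1 + t + t') s''
  | loop_neg {b : Test} {p : Program} {s : State} (hb : ¬ b.Holds s) :
      Exec W (.loop b p) s (b.cost + 1) s

/-! ### Input and output -/

/-- The list of lists `L` lists the clauses of `F`, and the literals of each clause, in an
arbitrary order and without repetition. -/
def Lists (L : List (List Lit)) (F : CNF) : Prop :=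
  (∀ C ∈ L, C.Nodup) ∧ (L.map List.toFinset).Nodup ∧ (L.map List.toFinset).toFinset = F

/-- The number of a literal: `2v` for the variable `v` and `2v + 1` for its complement. -/
def Lit.code (x : Lit) : ℕ := 2 * x.1 + if x.2 then 0 else 1

/-- The words of the input: the number of clauses, and then for each clause its length
followed by its literals. -/
def encode (L : List (List Lit)) : List ℕ :=
  L.length :: L.flatMap fun C => C.length :: C.map Lit.code

/-- Initially the memory holds the input from address `0` on, and is `0` elsewhere, as are all
registers. -/
def initState (L : List (List Lit)) : State := ⟨fun _ => 0, fun a => (encode L).getD a 0⟩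

/-- The memory of `s`, from address `a` on, holds the list of clauses `L`. -/
def Holds (s : State) (a : ℕ) (L : List (List Lit)) : Prop :=
  ∀ i < (encode L).length, s.mem (a + i) = (encode L).getD i 0

/-- The parameter for the word length: the number of words of the input plus the largest one
plus one; the words of the machine have logarithmic length in this number. -/
def wordParam (L : List (List Lit)) : ℕ := (encode L).length + (encode L).foldr max 0 + 1

/-- The bound `T F`, to be read as linear (in the formula size) where it is zero. -/
def timeTerm (T : CNF → ℕ) (F : CNF) : ℕ := if T F = 0 then size F + 1 else T F

/-- For 2-CNFs `F` without empty clause, it can be decided in time `O(T F)` whether `F` has an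
MUS with the property `Q`, and such an MUS is found if there is one: a single program
computes the answer in register `0` and, in the positive case, writes out an MUS with property
`Q`, starting at the address given by register `1`. -/
def FindsMUSInTime (Q : CNF → Prop) (T : CNF → ℕ) : Prop :=
  ∃ (p : Program) (c k : ℕ), ∀ F : CNF, IsTwoCNF F → ∀ L : List (List Lit), Lists L F →
    ∃ (t : ℕ) (s : State), Exec (wordParam L ^ k) p (initState L) t s ∧
      t ≤ c * timeTerm T F ∧
      ((∃ F', IsMUS F' F ∧ Q F') → s.reg 0 = 1 ∧
        ∃ (F' : CNF) (L' : List (List Lit)),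
          IsMUS F' F ∧ Q F' ∧ Lists L' F' ∧ Holds s (s.reg 1) L') ∧
      ((¬ ∃ F', IsMUS F' F ∧ Q F') → s.reg 0 = 0)

end TwoCNF

namespace TwoCNF

/-! ### Literals and chains -/

/-! A two-literal clause `{ā, b}` amounts to the implications `a → b` and `b̄ → ā`. A clause-set in
the class is thus a digraph on the literals, closed under contraposition, in which the unit literals
are forced.

Let `F` be minimally unsatisfiable with a unit-clause `{u}`. Suppose that no unit literal reaches
the complement of a unit literal. Then the set of literals reached from units is consistent: if `x`
reaches `a` and `y` reaches `ā`, then by contraposition `x` reaches `ȳ`. Making these literals true,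
and following a satisfying assignment of `F \ {{u}}` elsewhere, would satisfy `F`. Hence some unit
literal `x` reaches some `ȳ` with `{y}` in `F` (`exists_units_reaches`). A path from `x` with its
repetitions cut out either ends in `ȳ` with all variables different, which gives Family I, or runs
into the complement of one of its own literals, a "lasso", which gives Family II
(`Reaches.exists_chain`). Both shapes are minimally unsatisfiable (`isMU_of_chain`,
`isMU_of_lasso`): propagation along the chain yields a contradiction, and once a clause is removed
it suffices to make the literals before the gap true and those after it false. An unsatisfiable
subset of `F` is all of `F`. Members of Family I have two different unit-clauses, those of Family II
exactly one.

The same criterion drives the algorithm. An MUS with a unit-clause exists iff some unit literal `x`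
reaches some `ȳ`; one with exactly one unit-clause exists iff some unit literal `x` reaches `x̄`.
Breadth-first search is run from each unit literal. Visited literals are stamped with the number of
the round, so nothing is ever cleared, and a round is linear in the numbers of edges and units,
whose sum is the formula size. On success, parents are followed from `ȳ` towards `x`. Read
contrapositively this is a chain leaving `y`, and it is stopped at the first literal whose
complement has been visited (a lasso from `y`, one unit-clause) or else at the root (a chain from
`y` to `x̄`, two unit-clauses). For `x = y` the first case always occurs, since the start `x̄` is
complementary to the root. -/

@[simp] theorem Lit.compl_fst (x : Lit) : x.compl.1 = x.1 := rfl

@[simp] theorem Lit.compl_snd (x : Lit) : x.compl.2 = !x.2 := rfl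

@[simp] theorem Lit.compl_compl (x : Lit) : x.compl.compl = x := by
  simp [Lit.compl]

theorem Lit.compl_ne (x : Lit) : x.compl ≠ x := by
  intro h
  have := congrArg Prod.snd h
  simp at this

theorem Lit.compl_injective : Function.Injective Lit.compl := fun x y h => by
  rw [← x.compl_compl, h, y.compl_compl]

theorem Lit.eq_or_eq_compl {x y : Lit} (h : x.1 = y.1) : x = y ∨ x = y.compl := by
  obtain ⟨v, a⟩ := x
  obtain ⟨w, b⟩ := y
  cases a <;> cases b <;> simp_all [Lit.compl]

theorem mem_chainClauses {l : List Lit} {C : Clause} :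
    C ∈ chainClauses l ↔ ∃ (i : ℕ) (h : i + 1 < l.length), C = {Lit.compl l[i], l[i + 1]} := by
  induction l with
  | nil => simp [chainClauses]
  | cons a t ih =>
    cases t with
    | nil => simp [chainClauses]
    | cons b r =>
      rw [chainClauses, Finset.mem_insert, ih]
      constructor
      · rintro (h | ⟨i, hi, h⟩)
        · exact ⟨0, by simp, by simpa using h⟩
        · exact ⟨i + 1, by simpa using hi, by simpa using h⟩
      · rintro ⟨i, hi, h⟩
        cases i with
        | zero => left; simpa using h
        | succ i => right; exact ⟨i, by simpa using hi, by simpa using h⟩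

theorem chainClauses_append_pair (l : List Lit) (a b : Lit) :
    chainClauses (l ++ [a, b]) = insert {Lit.compl a, b} (chainClauses (l ++ [a])) := by
  induction l with
  | nil => simp [chainClauses]
  | cons c t ih =>
    cases t with
    | nil => simpa [chainClauses] using Finset.pair_comm _ _
    | cons d r =>
      simp only [List.cons_append, chainClauses] at ih ⊢
      rw [ih, Finset.insert_comm]

/-- Unit propagation along the chain. -/
theorem satisfies_chain {φ : ℕ → Option Bool} {l : List Lit} {x : Lit}
    (h : Satisfies φ (chainClauses l)) (hx : l.head? = some x) (hφ : φ x.1 = some x.2) :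
    ∀ a ∈ l, φ a.1 = some a.2 := by
  induction l generalizing x with
  | nil => simp
  | cons a t ih =>
    obtain rfl : a = x := by simpa using hx
    cases t with
    | nil => simpa using hφ
    | cons b r =>
      have hb : φ b.1 = some b.2 := by
        obtain ⟨z, hz, hz'⟩ := h {Lit.compl a, b} (by simp [chainClauses])
        rcases Finset.mem_insert.1 hz with rfl | hz
        · simp [hφ] at hz'
        · rwa [← Finset.mem_singleton.1 hz]
      intro c hc
      rcases List.mem_cons.1 hc with rfl | hc
      · exact hφ
      · exact ih (fun C hC => h C (by simp [chainClauses, hC])) rfl hb c hc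

/-- Literals before position `j` become true, the others false. An implication between neighbours
then fails only across the threshold, which is what deleting one clause permits. -/
theorem exists_threshold_assignment {l : List Lit} (hl : DistinctVars l) (j : ℕ) :
    ∃ φ : ℕ → Option Bool, ∀ (i : ℕ) (h : i < l.length),
      (i < j → φ l[i].1 = some l[i].2) ∧ (j ≤ i → φ l[i].1 = some (!l[i].2)) := by
  classical
  refine ⟨fun v => if ∃ (i : ℕ) (h : i < l.length), l[i].1 = v ∧
    (if i < j then l[i].2 else !l[i].2) = true then some true else some false, fun i h => ?_⟩
  have key : ∀ (k : ℕ) (hk : k < l.length), l[k].1 = l[i].1 → k = i := fun k hk e =>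
    (List.Nodup.getElem_inj_iff hl (hi := by simpa using hk) (hj := by simpa using h)).1
      (by simpa using e)
  have : (∃ (k : ℕ) (hk : k < l.length), l[k].1 = l[i].1 ∧
      (if k < j then l[k].2 else !l[k].2) = true) ↔ (if i < j then l[i].2 else !l[i].2) = true := by
    constructor
    · rintro ⟨k, hk, e, h'⟩
      obtain rfl := key k hk e
      exact h'
    · exact fun h' => ⟨i, h, rfl, h'⟩
  simp only [this]
  constructor
  · intro hij
    cases l[i].2 <;> simp [hij]
  · intro hij
    cases l[i].2 <;> simp [Nat.not_lt.2 hij]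

/-- Two unit-clauses and a chain between them form a minimally unsatisfiable clause-set. -/
theorem isMU_of_chain {F : CNF} (hF : IsClauseSet F) {l : List Lit} {x y : Lit}
    (hl : DistinctVars l) (hx : l.head? = some x) (hy : l.getLast? = some (Lit.compl y))
    (h : F = {{x}, {y}} ∪ chainClauses l) : IsMU F := by
  subst h
  have hpos : 0 < l.length := by cases l <;> simp_all
  have hx0 : l[0] = x := by
    rw [List.head?_eq_getElem?, List.getElem?_eq_getElem hpos] at hx; simpa using hx
  have hyn : l[l.length - 1] = Lit.compl y := by
    rw [List.getLast?_eq_getElem?, List.getElem?_eq_getElem (by omega)] at hy; simpa using hy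
  refine ⟨hF, ?_, ?_⟩
  · rintro ⟨φ, hφ⟩
    have h1 : φ x.1 = some x.2 := by simpa using hφ {x} (by simp)
    have h2 : φ y.1 = some y.2 := by simpa using hφ {y} (by simp)
    have := satisfies_chain (fun C hC => hφ C (Finset.mem_union_right _ hC)) hx h1
      (Lit.compl y) (List.mem_of_getLast? hy)
    simp [h2] at this
  · have sat : ∀ j, ∃ φ : ℕ → Option Bool, (0 < j → φ x.1 = some x.2) ∧
        (j < l.length → φ y.1 = some y.2) ∧ ∀ (i : ℕ) (h : i + 1 < l.length), i + 1 ≠ j →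
          ∃ z ∈ ({Lit.compl l[i], l[i + 1]} : Clause), φ z.1 = some z.2 := by
      intro j
      obtain ⟨φ, hφ⟩ := exists_threshold_assignment hl j
      refine ⟨φ, fun hj => ?_, fun hj => ?_, fun i hi hij => ?_⟩
      · have := (hφ 0 hpos).1 hj
        rwa [hx0] at this
      · have := (hφ (l.length - 1) (by omega)).2 (by omega)
        rw [hyn] at this
        simpa using this
      · rcases Nat.lt_or_ge (i + 1) j with h | h
        · exact ⟨l[i + 1], by simp, (hφ _ hi).1 h⟩
        · exact ⟨Lit.compl l[i], by simp, by simpa using (hφ i (by omega)).2 (by omega)⟩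
    intro C hC
    -- Only clauses different from `C` as sets have to be satisfied, so it need not be shown that
    -- different positions of the chain carry different clauses.
    have fin : ∀ φ : ℕ → Option Bool, (({x} : Clause) ≠ C → φ x.1 = some x.2) →
        (({y} : Clause) ≠ C → φ y.1 = some y.2) → (∀ (i : ℕ) (h : i + 1 < l.length),
          ({Lit.compl l[i], l[i + 1]} : Clause) ≠ C →
          ∃ z ∈ ({Lit.compl l[i], l[i + 1]} : Clause), φ z.1 = some z.2) →
        Satisfies φ (({{x}, {y}} ∪ chainClauses l : CNF).erase C) := by
      intro φ h1 h2 h3 D hD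
      obtain ⟨hDC, hD⟩ := Finset.mem_erase.1 hD
      rcases Finset.mem_union.1 hD with hD | hD
      · rcases Finset.mem_insert.1 hD with rfl | hD
        · exact ⟨x, by simp, h1 hDC⟩
        · obtain rfl := Finset.mem_singleton.1 hD
          exact ⟨y, by simp, h2 hDC⟩
      · obtain ⟨i, hi, rfl⟩ := mem_chainClauses.1 hD
        exact h3 i hi hDC
    rcases Finset.mem_union.1 hC with hC | hC
    · rcases Finset.mem_insert.1 hC with rfl | hC
      · obtain ⟨φ, h1, h2, h3⟩ := sat 0
        exact ⟨φ, fin φ (by simp) (fun _ => h2 hpos) fun i hi _ => h3 i hi (by omega)⟩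
      · obtain rfl := Finset.mem_singleton.1 hC
        obtain ⟨φ, h1, h2, h3⟩ := sat l.length
        exact ⟨φ, fin φ (fun _ => h1 hpos) (by simp) fun i hi _ => h3 i hi (by omega)⟩
    -- The clause from position `k` to `k + 1` is the only one violated by the threshold `k + 1`;
    -- the thresholds `0` and `l.length` above violate only `{x}` and `{y}`.
    · obtain ⟨k, hk, rfl⟩ := mem_chainClauses.1 hC
      obtain ⟨φ, h1, h2, h3⟩ := sat (k + 1)
      refine ⟨φ, fin φ (fun _ => h1 (by omega)) (fun _ => h2 hk) fun i hi hne => h3 i hi ?_⟩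
      rintro h
      obtain rfl : i = k := by omega
      exact hne rfl

/-- A unit-clause and a chain from its literal that finally returns to the complement of one of
its literals form a minimally unsatisfiable clause-set. -/
theorem isMU_of_lasso {F : CNF} (hF : IsClauseSet F) {l : List Lit} {x w : Lit}
    (hl : DistinctVars l) (hx : l.head? = some x) (hw : w ∈ l)
    (h : F = {{x}} ∪ chainClauses (l ++ [Lit.compl w])) : IsMU F := by
  subst h
  have hpos : 0 < l.length := by cases l <;> simp_all
  have hx0 : l[0] = x := by
    rw [List.head?_eq_getElem?, List.getElem?_eq_getElem hpos] at hx; simpa using hx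
  refine ⟨hF, ?_, ?_⟩
  · rintro ⟨φ, hφ⟩
    have h1 : φ x.1 = some x.2 := by simpa using hφ {x} (by simp)
    have := satisfies_chain (fun C hC => hφ C (Finset.mem_union_right _ hC))
      (by rw [List.head?_append, hx]; rfl) h1
    have h2 := this w (by simp [hw])
    have h3 := this (Lit.compl w) (by simp)
    simp [h2] at h3
  · have sat : ∀ j ≤ l.length, ∃ φ : ℕ → Option Bool, (0 < j → φ x.1 = some x.2) ∧
        ∀ (i : ℕ) (h : i + 1 < (l ++ [Lit.compl w]).length), i + 1 ≠ j → ∃ z ∈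
          ({Lit.compl (l ++ [Lit.compl w])[i], (l ++ [Lit.compl w])[i + 1]} : Clause),
          φ z.1 = some z.2 := by
      intro j hjl
      obtain ⟨φ, hφ⟩ := exists_threshold_assignment hl j
      refine ⟨φ, fun hj => ?_, fun i hi hij => ?_⟩
      · have := (hφ 0 hpos).1 hj
        rwa [hx0] at this
      · have hi' : i < l.length := by simpa using hi
        rw [List.getElem_append_left hi']
        rcases Nat.lt_or_ge (i + 1) j with h | h
        · rw [List.getElem_append_left (by omega)]
          exact ⟨l[i + 1], by simp, (hφ _ (by omega)).1 h⟩
        -- This also covers the closing clause, through its source: the value of `w` plays no role,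
        -- because the source is true only if the closing clause is the deleted one.
        · exact ⟨Lit.compl l[i], by simp, by simpa using (hφ i hi').2 (by omega)⟩
    intro C hC
    have fin : ∀ φ : ℕ → Option Bool, (({x} : Clause) ≠ C → φ x.1 = some x.2) →
        (∀ (i : ℕ) (h : i + 1 < (l ++ [Lit.compl w]).length),
          ({Lit.compl (l ++ [Lit.compl w])[i], (l ++ [Lit.compl w])[i + 1]} : Clause) ≠ C →
          ∃ z ∈ ({Lit.compl (l ++ [Lit.compl w])[i], (l ++ [Lit.compl w])[i + 1]} : Clause),
            φ z.1 = some z.2) →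
        Satisfies φ (({{x}} ∪ chainClauses (l ++ [Lit.compl w]) : CNF).erase C) := by
      intro φ h1 h3 D hD
      obtain ⟨hDC, hD⟩ := Finset.mem_erase.1 hD
      rcases Finset.mem_union.1 hD with hD | hD
      · obtain rfl := Finset.mem_singleton.1 hD
        exact ⟨x, by simp, h1 hDC⟩
      · obtain ⟨i, hi, rfl⟩ := mem_chainClauses.1 hD
        exact h3 i hi hDC
    rcases Finset.mem_union.1 hC with hC | hC
    · obtain rfl := Finset.mem_singleton.1 hC
      obtain ⟨φ, h1, h3⟩ := sat 0 (by omega)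
      exact ⟨φ, fin φ (by simp) fun i hi _ => h3 i hi (by omega)⟩
    · obtain ⟨k, hk, rfl⟩ := mem_chainClauses.1 hC
      obtain ⟨φ, h1, h3⟩ := sat (k + 1) (by simpa using hk)
      refine ⟨φ, fin φ (fun _ => h1 (by omega)) fun i hi hne => h3 i hi ?_⟩
      rintro h
      obtain rfl : i = k := by omega
      exact hne rfl

/-! ### The two families -/

theorem familyI_of_chain {F : CNF} {l : List Lit} {x y : Lit}
    (hl : DistinctVars l) (hx : l.head? = some x) (hy : l.getLast? = some (Lit.compl y))
    (h : F = {{x}, {y}} ∪ chainClauses l) : FamilyI F := by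
  cases l with
  | nil => simp at hx
  | cons a t =>
    obtain rfl : a = x := by simpa using hx
    rcases List.eq_nil_or_concat t with rfl | ⟨zs, b, rfl⟩
    -- A chain of a single literal means `x = ȳ`.
    · left
      have hy : a = Lit.compl y := by simpa using hy
      refine ⟨a, ?_⟩
      simp [h, hy, chainClauses]
    · right
      have hy : b = Lit.compl y := by
        simpa [List.getLast?_cons] using hy
      subst hy
      refine ⟨a, y, zs, ?_, by simpa using h⟩
      simpa [DistinctVars] using hl

/-- The two forms correspond to the position of `w`: at the start of the chain, or later. The
condition on the last literal makes the returning part nonempty. -/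
theorem familyII_of_lasso {F : CNF} {l : List Lit} {x w : Lit}
    (hl : DistinctVars l) (hx : l.head? = some x) (hw : w ∈ l) (hlast : l.getLast? ≠ some w)
    (h : F = {{x}} ∪ chainClauses (l ++ [Lit.compl w])) : FamilyII F := by
  obtain ⟨l₁, l₂, rfl⟩ := List.append_of_mem hw
  have hne : l₂ ≠ [] := by
    rintro rfl
    simp at hlast
  cases l₁ with
  | nil =>
    obtain rfl : w = x := by simpa using hx
    exact Or.inl ⟨w, l₂, hne, by simpa using hl, by simpa using h⟩
  | cons a t =>
    obtain rfl : a = x := by simpa using hx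
    exact Or.inr ⟨a, w, t, l₂, hne, by simpa using hl, by simpa using h⟩

theorem one_le_unitCount {F : CNF} {x : Lit} (h : ({x} : Clause) ∈ F) : 1 ≤ unitCount F :=
  Finset.card_pos.2 ⟨{x}, by simp [h]⟩

theorem exists_unit_of_unitCount {F : CNF} (h : 1 ≤ unitCount F) :
    ∃ x : Lit, ({x} : Clause) ∈ F := by
  obtain ⟨C, hC⟩ := Finset.card_pos.1 h
  obtain ⟨hC, h1⟩ := Finset.mem_filter.1 hC
  obtain ⟨x, rfl⟩ := Finset.card_eq_one.1 h1
  exact ⟨x, hC⟩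

theorem unit_unique {F : CNF} (h : unitCount F = 1) {x y : Lit} (hx : ({x} : Clause) ∈ F)
    (hy : ({y} : Clause) ∈ F) : x = y := by
  have := Finset.card_le_one.1 h.le {x} (by simp [hx]) {y} (by simp [hy])
  simpa using this

theorem FamilyI.exists_units {F : CNF} (h : FamilyI F) :
    ∃ x y : Lit, x ≠ y ∧ ({x} : Clause) ∈ F ∧ ({y} : Clause) ∈ F := by
  rcases h with ⟨x, rfl⟩ | ⟨x, y, zs, hd, rfl⟩
  · exact ⟨x, Lit.compl x, x.compl_ne.symm, by simp, by simp⟩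
  · refine ⟨x, y, ?_, by simp, by simp⟩
    rintro rfl
    simp [DistinctVars] at hd

/-- Neighbours on the chain have different variables, also across the closing step by `hlast`, so
every chain clause has two literals. -/
theorem unitCount_eq_one_of_lasso {F : CNF} {l : List Lit} {x w : Lit}
    (hl : DistinctVars l) (hlast : l.getLast?.map Prod.fst ≠ some w.1)
    (h : F = {{x}} ∪ chainClauses (l ++ [Lit.compl w])) : unitCount F = 1 := by
  have : F.filter (fun C => C.card = 1) = {{x}} := by
    ext C
    simp only [h, Finset.mem_filter, Finset.mem_union, Finset.mem_singleton]
    constructor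
    · rintro ⟨rfl | hC, h1⟩
      · rfl
      · obtain ⟨i, hi, rfl⟩ := mem_chainClauses.1 hC
        exfalso
        have hi' : i < l.length := by simpa using hi
        have hne : (l ++ [Lit.compl w])[i].1 ≠ (l ++ [Lit.compl w])[i + 1].1 := by
          rw [List.getElem_append_left hi']
          rcases Nat.lt_or_ge (i + 1) l.length with h | h
          · rw [List.getElem_append_left h]
            intro e
            have := (List.Nodup.getElem_inj_iff hl (i := i) (j := i + 1) (hi := by simpa using hi')
              (hj := by simpa using h)).1 (by simpa using e)
            omega
          · have : i = l.length - 1 := by omega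
            subst this
            rw [List.getElem_append_right h]
            intro e
            apply hlast
            rw [List.getLast?_eq_getElem?, List.getElem?_eq_getElem (by omega)]
            simpa using e
        rw [Finset.card_pair] at h1
        · omega
        · intro e
          exact hne (by rw [← e]; rfl)
    · rintro rfl
      exact ⟨Or.inl rfl, by simp⟩
  rw [unitCount, this, Finset.card_singleton]

theorem FamilyII.unitCount_eq_one {F : CNF} (h : FamilyII F) : unitCount F = 1 := by
  rcases h with ⟨x, zs, hne, hd, h⟩ | ⟨x, y, zs, ws, hne, hd, h⟩
  · refine unitCount_eq_one_of_lasso hd ?_ h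
    rcases List.eq_nil_or_concat zs with rfl | ⟨zs, b, rfl⟩
    · exact absurd rfl hne
    · simp [DistinctVars, List.getLast?_cons] at hd ⊢
      grind
  · refine unitCount_eq_one_of_lasso hd ?_ h
    rcases List.eq_nil_or_concat ws with rfl | ⟨zs, b, rfl⟩
    · exact absurd rfl hne
    · simp [DistinctVars, List.getLast?_cons] at hd ⊢
      grind

/-! ### Implications between literals -/

/-- The two-literal clause that makes `a` imply `b` is present. -/
def Implies (F : CNF) (a b : Lit) : Prop := a.1 ≠ b.1 ∧ ({Lit.compl a, b} : Clause) ∈ F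

abbrev Reaches (F : CNF) : Lit → Lit → Prop := Relation.ReflTransGen (Implies F)

theorem Implies.contrapose {F : CNF} {a b : Lit} (h : Implies F a b) :
    Implies F b.compl a.compl := by
  refine ⟨h.1.symm, ?_⟩
  rw [Lit.compl_compl, Finset.pair_comm]
  exact h.2

theorem Reaches.contrapose {F : CNF} {a b : Lit} (h : Reaches F a b) :
    Reaches F b.compl a.compl := by
  induction h with
  | refl => exact .refl
  | tail _ h ih => exact .head h.contrapose ih

theorem Implies.mono {F F' : CNF} (hF : F ⊆ F') {a b : Lit} (h : Implies F a b) :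
    Implies F' a b := ⟨h.1, hF h.2⟩

theorem chainClauses_subset {F : CNF} {l : List Lit} (h : l.IsChain (Implies F)) :
    chainClauses l ⊆ F := by
  intro C hC
  obtain ⟨i, hi, rfl⟩ := mem_chainClauses.1 hC
  exact (List.isChain_iff_getElem.1 h i hi).2

/-- Otherwise the literals reached from units could be made true consistently, and a satisfying
assignment of `F` without one unit-clause would serve on the remaining variables. -/
theorem exists_units_reaches {F : CNF} (hF : IsTwoCNF F) (h : IsMU F) (hu : 1 ≤ unitCount F) :
    ∃ x y : Lit, ({x} : Clause) ∈ F ∧ ({y} : Clause) ∈ F ∧ Reaches F x y.compl := by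
  by_contra! hno
  obtain ⟨u, hu⟩ := exists_unit_of_unitCount hu
  obtain ⟨ψ, hψ⟩ := h.2.2 _ hu
  let R : Lit → Prop := fun a => ∃ x : Lit, ({x} : Clause) ∈ F ∧ Reaches F x a
  have hR : ∀ a, R a → ¬ R a.compl := by
    rintro a ⟨x, hx, hxa⟩ ⟨y, hy, hya⟩
    refine hno x y hx hy (hxa.trans ?_)
    simpa using hya.contrapose
  classical
  refine h.2.1 ⟨fun v => if R (v, true) then some true else if R (v, false) then some false
    else ψ v, fun C hC => ?_⟩
  have val : ∀ a : Lit, R a → (if R (a.1, true) then some true else if R (a.1, false) then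
      some false else ψ a.1) = some a.2 := by
    rintro ⟨v, b⟩ ha
    cases b
    · have := hR _ ha
      simp only [Lit.compl, Bool.not_false] at this
      simp [this, ha]
    · simp [ha]
  by_cases hCR : ∃ a ∈ C, R a
  · obtain ⟨a, ha, h'⟩ := hCR
    exact ⟨a, ha, val a h'⟩
  -- A clause without reached literals differs from `{u}`, so `ψ` satisfies it at some `z`. It
  -- remains to see that neither `z` nor its complement is reached, so that `ψ` has not been
  -- overridden at `z`.
  · have hCu : C ≠ {u} := by
      rintro rfl
      exact hCR ⟨u, by simp, u, hu, .refl⟩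
    obtain ⟨z, hz, hz'⟩ := hψ C (Finset.mem_erase.2 ⟨hCu, hC⟩)
    refine ⟨z, hz, ?_⟩
    have h1 : ¬ R z := fun h => hCR ⟨z, hz, h⟩
    have h2 : ¬ R z.compl := by
      rintro ⟨x, hx, hxz⟩
      have hcard := hF.2.1 C hC
      have : C.card ≠ 1 := by
        intro h1
        obtain ⟨w, rfl⟩ := Finset.card_eq_one.1 h1
        exact hCR ⟨w, by simp, w, hC, .refl⟩
      have hpos : 0 < C.card := Finset.card_pos.2 ⟨z, hz⟩
      obtain ⟨b, hb, hbz⟩ := Finset.exists_mem_ne (by omega : 1 < C.card) z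
      have hCe : C = {z, b} := by
        symm
        refine Finset.eq_of_subset_of_card_le ?_ ?_
        · intro c hc
          rcases Finset.mem_insert.1 hc with rfl | hc
          · exact hz
          · rwa [Finset.mem_singleton.1 hc]
        · rw [Finset.card_pair hbz.symm]; omega
      -- If the complement of `z` were reached, the clause `{z, b}` would carry the path on to `b`.
      refine hCR ⟨b, hb, x, hx, hxz.tail ⟨?_, ?_⟩⟩
      · intro e
        rcases Lit.eq_or_eq_compl (x := z) (y := b) e with e | e
        · exact hbz e.symm
        · exact hF.1 C hC b hb (e ▸ hz)
      · rw [Lit.compl_compl, ← hCe]; exact hC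
    obtain ⟨v, b⟩ := z
    cases b <;> simp_all [Lit.compl]

/-- Every literal reached from `x` is the end of a chain with distinct variables, unless there is
a lasso starting in `x`. -/
theorem Reaches.exists_chain {F : CNF} {x z : Lit} (h : Reaches F x z) :
    (∃ (l : List Lit) (w : Lit), DistinctVars l ∧ l.head? = some x ∧ w ∈ l ∧
      l.getLast? ≠ some w ∧ (l ++ [w.compl]).IsChain (Implies F)) ∨
    ∃ l : List Lit, DistinctVars l ∧ l.head? = some x ∧ l.getLast? = some z ∧
      l.IsChain (Implies F) := by
  induction h with
  | refl => exact Or.inr ⟨[x], by simp [DistinctVars], by simp, by simp, by simp⟩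
  | @tail b c _ hbc ih =>
    rcases ih with ih | ⟨l, hd, hx, hb, hc⟩
    · exact Or.inl ih
    have hext : ∀ d, Implies F b d → (l ++ [d]).IsChain (Implies F) := by
      intro d hd
      refine List.isChain_append.2 ⟨hc, by simp, ?_⟩
      intro p hp q hq
      simp only [hb, Option.mem_def, Option.some.injEq, List.head?_cons] at hp hq
      subst hp hq
      exact hd
    -- A repeated literal: the detour is cut off.
    by_cases h1 : c ∈ l
    · right
      obtain ⟨l₁, l₂, rfl⟩ := List.append_of_mem h1
      have e : l₁ ++ c :: l₂ = (l₁ ++ [c]) ++ l₂ := by simp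
      rw [e] at hd hc hx
      refine ⟨l₁ ++ [c], ?_, ?_, by simp, (List.isChain_append.1 hc).1⟩
      · rw [DistinctVars, List.map_append] at hd
        exact (List.nodup_append.1 hd).1
      · cases l₁ <;> simpa using hx
    -- A complementary literal closes a lasso with `w` the complement of `c`. The last literal `b`
    -- differs from `w`, since an implication joins different variables.
    by_cases h2 : c.compl ∈ l
    · left
      refine ⟨l, c.compl, hd, hx, h2, ?_, by simpa using hext c hbc⟩
      rw [hb]
      intro e
      apply hbc.1
      rw [Option.some.inj e]
      rfl
    · right
      refine ⟨l ++ [c], ?_, ?_, by simp, hext c hbc⟩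
      · rw [DistinctVars, List.map_append, List.nodup_append]
        refine ⟨hd, by simp, ?_⟩
        intro v hv w hw e
        obtain ⟨a, ha, rfl⟩ := List.mem_map.1 hv
        simp only [List.map_cons, List.map_nil, List.mem_singleton] at hw
        rcases Lit.eq_or_eq_compl (e.trans hw) with rfl | rfl
        · exact h1 ha
        · exact h2 ha
      · rw [List.head?_append, hx]; rfl

theorem exists_family_of_reaches {F : CNF} {x y : Lit} (hx : ({x} : Clause) ∈ F)
    (hy : ({y} : Clause) ∈ F) (h : Reaches F x y.compl) :
    ∃ F' ⊆ F, (FamilyI F' ∨ FamilyII F') ∧ (IsClauseSet F' → IsMU F') := by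
  rcases h.exists_chain with ⟨l, w, hd, hl, hw, hlast, hc⟩ | ⟨l, hd, hl, hlast, hc⟩
  · refine ⟨{{x}} ∪ chainClauses (l ++ [w.compl]), ?_, Or.inr (familyII_of_lasso hd hl hw hlast rfl),
      fun hF => isMU_of_lasso hF hd hl hw rfl⟩
    exact Finset.union_subset (by simpa using hx) (chainClauses_subset hc)
  · refine ⟨{{x}, {y}} ∪ chainClauses l, ?_, Or.inl (familyI_of_chain hd hl hlast rfl),
      fun hF => isMU_of_chain hF hd hl hlast rfl⟩
    refine Finset.union_subset ?_ (chainClauses_subset hc)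
    intro C hC
    rcases Finset.mem_insert.1 hC with rfl | hC
    · exact hx
    · rwa [Finset.mem_singleton.1 hC]

theorem IsTwoCNF.mono {F F' : CNF} (hF : IsTwoCNF F) (h : F' ⊆ F) : IsTwoCNF F' :=
  ⟨fun C hC => hF.1 C (h hC), fun C hC => hF.2.1 C (h hC), fun h' => hF.2.2 (h h')⟩

/-- A minimally unsatisfiable clause-set has no proper unsatisfiable subset. -/
theorem IsMU.eq_of_subset {F F' : CNF} (h : IsMU F) (h' : F' ⊆ F) (hu : ¬ Satisfiable F') :
    F' = F := by
  refine h'.antisymm fun C hC => ?_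
  by_contra hC'
  obtain ⟨φ, hφ⟩ := h.2.2 C hC
  exact hu ⟨φ, fun D hD => hφ D (Finset.mem_erase.2 ⟨fun e => hC' (e ▸ hD), h' hD⟩)⟩

theorem IsMU.family_of_unit {F : CNF} (hF : IsTwoCNF F) (h : IsMU F) (hu : 1 ≤ unitCount F) :
    FamilyI F ∨ FamilyII F := by
  obtain ⟨x, y, hx, hy, hxy⟩ := exists_units_reaches hF h hu
  obtain ⟨F', hsub, hfam, hmu⟩ := exists_family_of_reaches hx hy hxy
  rwa [← h.eq_of_subset hsub (hmu (hF.mono hsub).1).2.1]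

theorem unit_characterization {F : CNF} (hF : IsTwoCNF F) (h : IsMU F) :
    (1 ≤ unitCount F ↔ FamilyI F ∨ FamilyII F) ∧ (unitCount F = 1 ↔ FamilyII F) := by
  refine ⟨⟨h.family_of_unit hF, ?_⟩, ⟨fun hu => ?_, FamilyII.unitCount_eq_one⟩⟩
  · rintro (h | h)
    · obtain ⟨x, -, -, hx, -⟩ := h.exists_units
      exact one_le_unitCount hx
    · exact h.unitCount_eq_one.ge
  · refine (h.family_of_unit hF hu.ge).resolve_left fun hI => ?_
    obtain ⟨x, y, hne, hx, hy⟩ := hI.exists_units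
    exact hne (unit_unique hu hx hy)

/-! ### Running programs -/

/-- The program halts within `B` steps in a state with the property `Q`. -/
def Runs (W : ℕ) (p : Program) (s : State) (B : ℕ) (Q : State → Prop) : Prop :=
  ∃ t s', Exec W p s t s' ∧ t ≤ B ∧ Q s'

/-- A bound for the running time of loop-free programs. -/
def Program.cost : Program → ℕ
  | .skip => 1
  | .assign _ e => e.cost + 1
  | .store a e => a.cost + e.cost + 1
  | .seq p q => p.cost + q.cost
  | .branch b p q => b.cost + 1 + (p.cost + q.cost)
  -- A dummy value: `Program.wp` is false for loops, so `Program.wp_runs` never uses it.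
  | .loop _ _ => 0

/-- Weakest preconditions of loop-free programs. -/
def Program.wp (W : ℕ) : Program → (State → Prop) → State → Prop
  | .skip, Q, s => Q s
  | .assign i e, Q, s => e.eval s ≤ W ∧ Q (s.setReg i (e.eval s))
  | .store a e, Q, s => a.eval s ≤ W ∧ e.eval s ≤ W ∧ Q (s.setMem (a.eval s) (e.eval s))
  | .seq p q, Q, s => p.wp W (q.wp W Q) s
  | .branch b p q, Q, s => (b.Holds s → p.wp W Q s) ∧ (¬ b.Holds s → q.wp W Q s)
  | .loop _ _, _, _ => False

variable {W : ℕ}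

theorem Program.wp_runs {p : Program} {Q : State → Prop} {s : State} (h : p.wp W Q s) :
    Runs W p s p.cost Q := by
  induction p generalizing Q s with
  | skip => exact ⟨1, s, .skip s, le_rfl, h⟩
  | assign i e => exact ⟨_, _, .assign i e s h.1, le_rfl, h.2⟩
  | store a e => exact ⟨_, _, .store a e s h.1 h.2.1, le_rfl, h.2.2⟩
  | seq p q ihp ihq =>
    obtain ⟨t, s', h1, ht, h'⟩ := ihp h
    obtain ⟨t', s'', h2, ht', h''⟩ := ihq h'
    exact ⟨_, _, .seq h1 h2, Nat.add_le_add ht ht', h''⟩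
  | branch b p q ihp ihq =>
    by_cases hb : b.Holds s
    · obtain ⟨t, s', h1, ht, h'⟩ := ihp (h.1 hb)
      exact ⟨_, _, .branch_pos hb h1, by simp only [Program.cost]; omega, h'⟩
    · obtain ⟨t, s', h1, ht, h'⟩ := ihq (h.2 hb)
      exact ⟨_, _, .branch_neg hb h1, by simp only [Program.cost]; omega, h'⟩
  | loop b p => exact h.elim

theorem Runs.mono {p : Program} {Q Q' : State → Prop} {s : State} {B B' : ℕ}
    (h : Runs W p s B Q) (hB : B ≤ B') (hQ : ∀ s', Q s' → Q' s') : Runs W p s B' Q' := by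
  obtain ⟨t, s', h1, ht, h'⟩ := h
  exact ⟨t, s', h1, ht.trans hB, hQ _ h'⟩

theorem Runs.seq {p q : Program} {Q Q' : State → Prop} {s : State} {B B' : ℕ}
    (hp : Runs W p s B Q) (hq : ∀ s', Q s' → Runs W q s' B' Q') :
    Runs W (.seq p q) s (B + B') Q' := by
  obtain ⟨t, s', h1, ht, h'⟩ := hp
  obtain ⟨t', s'', h2, ht', h''⟩ := hq s' h'
  exact ⟨_, _, .seq h1 h2, Nat.add_le_add ht ht', h''⟩

/-- The index of the invariant is a decreasing measure. It may drop by more than one, which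
accommodates early exits; the extra `1` pays for the final failing test. -/
theorem Runs.loop {b : Test} {p : Program} {I : ℕ → State → Prop} {Q : State → Prop} {B : ℕ}
    (step : ∀ n s, I n s → b.Holds s → Runs W p s B fun s' => ∃ n' < n, I n' s')
    (done : ∀ n s, I n s → ¬ b.Holds s → Q s) {n : ℕ} {s : State} (h : I n s) :
    Runs W (.loop b p) s ((n + 1) * (b.cost + 1 + B)) Q := by
  induction n using Nat.strong_induction_on generalizing s with
  | _ n ih =>
    by_cases hb : b.Holds s
    · obtain ⟨t, s', h1, ht, n', hn, h'⟩ := step n s h hb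
      obtain ⟨t', s'', h2, ht', h''⟩ := ih n' hn h'
      refine ⟨_, _, .loop_pos hb h1 h2, ?_, h''⟩
      have : (n' + 1) * (b.cost + 1 + B) ≤ n * (b.cost + 1 + B) := Nat.mul_le_mul_right _ hn
      rw [Nat.add_mul n]
      omega
    · refine ⟨_, _, .loop_neg hb, ?_, done n s h hb⟩
      rw [Nat.add_mul]
      omega

infixr:60 " ;; " => Program.seq

/-! ### Interleaved arrays

From the address in register `3` on, the memory is divided into eight interleaved arrays. -/

/-- The entry `i` of the array `j`. -/
def State.arr (s : State) (j i : ℕ) : ℕ := s.mem (s.reg 3 + (8 * i + j))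

def State.setArr (s : State) (j i v : ℕ) : State := s.setMem (s.reg 3 + (8 * i + j)) v

/-- Eight times the value of an expression. -/
def RExpr.oct (e : RExpr) : RExpr :=
  .add (.add (.add e e) (.add e e)) (.add (.add e e) (.add e e))

def RExpr.cell (j : ℕ) (e : RExpr) : RExpr := .add (.reg 3) (.add e.oct (.const j))

def RExpr.get (j : ℕ) (e : RExpr) : RExpr := .load (.cell j e)

/-- The number of the complementary literal. -/
def complCode (c : ℕ) : ℕ := 4 * (c / 2) + 1 - c

def RExpr.compl (e : RExpr) : RExpr :=
  .sub (.add (.add (.add (.half e) (.half e)) (.add (.half e) (.half e))) (.const 1)) e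

def Program.storeAt (j : ℕ) (i e : RExpr) : Program := .store (.cell j i) e

/-! ### Symbolic evaluation of expressions and programs -/

section Eval

variable (s : State) (e f : RExpr)

@[simp] theorem RExpr.eval_const (n : ℕ) : (RExpr.const n).eval s = n := rfl
@[simp] theorem RExpr.eval_reg (i : ℕ) : (RExpr.reg i).eval s = s.reg i := rfl
@[simp] theorem RExpr.eval_add : (RExpr.add e f).eval s = e.eval s + f.eval s := rfl
@[simp] theorem RExpr.eval_sub : (RExpr.sub e f).eval s = e.eval s - f.eval s := rfl
@[simp] theorem RExpr.eval_half : (RExpr.half e).eval s = e.eval s / 2 := rfl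
@[simp] theorem RExpr.eval_load : (RExpr.load e).eval s = s.mem (e.eval s) := rfl

@[simp] theorem RExpr.eval_oct : e.oct.eval s = 8 * e.eval s := by
  simp only [RExpr.oct, RExpr.eval_add]; omega

@[simp] theorem RExpr.eval_cell (j : ℕ) :
    (e.cell j).eval s = s.reg 3 + (8 * e.eval s + j) := by simp [RExpr.cell]

@[simp] theorem RExpr.eval_get (j : ℕ) : (e.get j).eval s = s.arr j (e.eval s) := by
  simp [RExpr.get, State.arr]

@[simp] theorem RExpr.eval_compl : e.compl.eval s = complCode (e.eval s) := by
  simp only [RExpr.compl, RExpr.eval_sub, RExpr.eval_add, RExpr.eval_half, RExpr.eval_const,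
    complCode]
  omega

@[simp] theorem Test.holds_lt : (Test.lt e f).Holds s ↔ e.eval s < f.eval s := Iff.rfl
@[simp] theorem Test.holds_eq : (Test.eq e f).Holds s ↔ e.eval s = f.eval s := Iff.rfl

variable (Q : State → Prop) (p q : Program) (b : Test)

@[simp] theorem Program.wp_skip : Program.skip.wp W Q s ↔ Q s := Iff.rfl

@[simp] theorem Program.wp_assign (i : ℕ) :
    (Program.assign i e).wp W Q s ↔ e.eval s ≤ W ∧ Q (s.setReg i (e.eval s)) := Iff.rfl

@[simp] theorem Program.wp_store : (Program.store e f).wp W Q s ↔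
    e.eval s ≤ W ∧ f.eval s ≤ W ∧ Q (s.setMem (e.eval s) (f.eval s)) := Iff.rfl

@[simp] theorem Program.wp_seq : (Program.seq p q).wp W Q s ↔ p.wp W (q.wp W Q) s := Iff.rfl

@[simp] theorem Program.wp_branch : (Program.branch b p q).wp W Q s ↔
    (b.Holds s → p.wp W Q s) ∧ (¬ b.Holds s → q.wp W Q s) := Iff.rfl

@[simp] theorem Program.wp_storeAt (j : ℕ) : (Program.storeAt j e f).wp W Q s ↔
    s.reg 3 + (8 * e.eval s + j) ≤ W ∧ f.eval s ≤ W ∧ Q (s.setArr j (e.eval s) (f.eval s)) := by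
  simp [Program.storeAt, State.setArr]

@[simp] theorem State.reg_setReg (i v k : ℕ) :
    (s.setReg i v).reg k = if k = i then v else s.reg k := Function.update_apply ..

@[simp] theorem State.mem_setReg (i v : ℕ) : (s.setReg i v).mem = s.mem := rfl
@[simp] theorem State.reg_setMem (a v : ℕ) : (s.setMem a v).reg = s.reg := rfl
@[simp] theorem State.reg_setArr (j i v : ℕ) : (s.setArr j i v).reg = s.reg := rfl

theorem State.mem_setMem (a v k : ℕ) :
    (s.setMem a v).mem k = if k = a then v else s.mem k := Function.update_apply ..

@[simp] theorem State.arr_setReg {i : ℕ} (hi : 3 ≠ i) (v : ℕ) : (s.setReg i v).arr = s.arr := by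
  funext j k
  simp [State.arr, hi]

@[simp] theorem State.arr_setArr (j i v : ℕ) :
    (s.setArr j i v).arr j = Function.update (s.arr j) i v := by
  funext k
  simp only [State.arr, State.setArr, State.mem_setMem, State.reg_setMem, Function.update_apply]
  congr 1
  simp

@[simp] theorem State.arr_setArr_ne {j j' : ℕ} (h : j' ≠ j) (hj : j < 8) (hj' : j' < 8)
    (i v : ℕ) : (s.setArr j i v).arr j' = s.arr j' := by
  funext k
  simp only [State.arr, State.setArr, State.mem_setMem, State.reg_setMem]
  rw [if_neg (by omega)]

theorem State.mem_setArr {a : ℕ} (ha : a < s.reg 3) (j i v : ℕ) :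
    (s.setArr j i v).mem a = s.mem a := by
  rw [State.setArr, State.mem_setMem, if_neg (by omega)]

theorem State.arr_setMem {a : ℕ} (ha : a < s.reg 3) (v : ℕ) : (s.setMem a v).arr = s.arr := by
  funext j k
  rw [State.arr, State.mem_setMem, State.reg_setMem, if_neg (by omega), State.arr]

end Eval

theorem complCode_le (c : ℕ) : complCode c ≤ c + 1 := by rw [complCode]; omega

theorem Lit.code_injective : Function.Injective Lit.code := by
  rintro ⟨v, a⟩ ⟨w, b⟩ h
  cases a <;> cases b <;> simp [Lit.code] at h ⊢ <;> omega

@[simp] theorem Lit.code_inj {x y : Lit} : x.code = y.code ↔ x = y := Lit.code_injective.eq_iff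

@[simp] theorem complCode_code (x : Lit) : complCode x.code = x.compl.code := by
  obtain ⟨v, a⟩ := x
  cases a <;> simp [Lit.code, Lit.compl, complCode] <;> omega

/-! ### Adjacency lists -/

/-- The edges `1, …, K`, where the edge `i` has the source `src i`, are organised in linked lists:
for each source, `head` is its last edge, and `next` leads to the previous edge with the same
source; the number `0` ends a list. -/
structure Links (K : ℕ) (src head next : ℕ → ℕ) : Prop where
  head_le : ∀ a, head a ≤ K
  head_src : ∀ a, head a ≠ 0 → src (head a) = a
  head_max : ∀ a i, head a < i → i ≤ K → src i ≠ a
  next_lt : ∀ i, 1 ≤ i → i ≤ K → next i < i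
  next_src : ∀ i, 1 ≤ i → i ≤ K → next i ≠ 0 → src (next i) = src i
  next_max : ∀ i j, i ≤ K → next i < j → j < i → src j ≠ src i

/-- The new edge becomes the head of its list and points to the old head. As edges are numbered in
order of insertion, each list is strictly decreasing. -/
theorem Links.push {K : ℕ} {src head next : ℕ → ℕ} (h : Links K src head next) (a : ℕ) :
    Links (K + 1) (Function.update src (K + 1) a) (Function.update head a (K + 1))
      (Function.update next (K + 1) (head a)) := by
  obtain ⟨h1, h2, h3, h4, h5, h6⟩ := h
  constructor
  · intro b
    have := h1 b
    grind [Function.update_apply]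
  · intro b
    have := h1 b
    have := h2 b
    grind [Function.update_apply]
  · intro b i
    have := h3 b i
    grind [Function.update_apply]
  · intro i
    have := h1 a
    have := h4 i
    grind [Function.update_apply]
  · intro i
    have := h1 a
    have := h4 i
    have := h2 a
    have := h5 i
    grind [Function.update_apply]
  · intro i j
    have := h3 a j
    have := h6 i j
    grind [Function.update_apply]

/-! ### Reading the input -/

/-- The input consists of unit-clauses and of two-literal clauses with different variables. -/
def IsTwoList (L : List (List Lit)) : Prop :=
  ∀ C ∈ L, (∃ p, C = [p]) ∨ ∃ p q : Lit, p.1 ≠ q.1 ∧ C = [p, q]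

def listImplies (L : List (List Lit)) (a b : Lit) : Prop := [a.compl, b] ∈ L ∨ [b, a.compl] ∈ L

/-- Reads one clause, enters it into the data structure, and decrements the number of clauses
left. -/
def scanBody : Program :=
  .assign 7 (.load (.add (.reg 4) (.const 1))) ;;
  .branch (.eq (.load (.reg 4)) (.const 1))
    (.storeAt 6 (.reg 5) (.reg 7) ;;
     .assign 5 (.add (.reg 5) (.const 1)) ;;
     .assign 4 (.add (.reg 4) (.const 2)))
    (.assign 8 (.load (.add (.reg 4) (.const 2))) ;;
     .assign 6 (.add (.reg 6) (.const 1)) ;;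
     .storeAt 2 (.reg 6) (.reg 8) ;;
     .storeAt 1 (.reg 6) (.get 0 (.compl (.reg 7))) ;;
     .storeAt 0 (.compl (.reg 7)) (.reg 6) ;;
     .assign 6 (.add (.reg 6) (.const 1)) ;;
     .storeAt 2 (.reg 6) (.reg 7) ;;
     .storeAt 1 (.reg 6) (.get 0 (.compl (.reg 8))) ;;
     .storeAt 0 (.compl (.reg 8)) (.reg 6) ;;
     .assign 4 (.add (.reg 4) (.const 3))) ;;
  .assign 2 (.sub (.reg 2) (.const 1))

/-- For `m` clauses the arrays start at `8 * (2 * m + 1)`. This lies beyond the at most `3 * m + 1`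
words of the input, so all arrays are initially zero, and it leaves room below for the output, which
overwrites the input. -/
def scanInit : Program :=
  .assign 2 (.load (.const 0)) ;;
  .assign 3 (.oct (.add (.add (.reg 2) (.reg 2)) (.const 1))) ;;
  .assign 4 (.const 1)

def scan : Program := scanInit ;; .loop (.lt (.const 0) (.reg 2)) scanBody

/-- The memory after reading the clauses `L`, where the whole input has `m` clauses. -/
structure Loaded (m : ℕ) (L : List (List Lit)) (src : ℕ → ℕ) (s : State) : Prop where
  answer : s.reg 0 = 0
  output : s.reg 1 = 0
  base : s.reg 3 = 8 * (2 * m + 1)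
  units : s.reg 5 = L.countP fun C => C.length = 1
  edges : s.reg 6 + 2 * s.reg 5 = 2 * L.length
  total : s.reg 6 + s.reg 5 = (L.map List.length).sum
  links : Links (s.reg 6) src (s.arr 0) (s.arr 1)
  edge_iff : ∀ a b, (∃ i, 1 ≤ i ∧ i ≤ s.reg 6 ∧ src i = a ∧ s.arr 2 i = b) ↔
    ∃ p q : Lit, listImplies L p q ∧ a = p.code ∧ b = q.code
  unit_iff : ∀ a, (∃ i < s.reg 5, s.arr 6 i = a) ↔ ∃ p : Lit, [p] ∈ L ∧ a = p.code
  seen : ∀ i, s.arr 3 i = 0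
  mark : ∀ i, s.arr 7 i = 0

def clauseWords (L : List (List Lit)) : List ℕ := L.flatMap fun C => C.length :: C.map Lit.code

theorem clauseWords_append (L L' : List (List Lit)) :
    clauseWords (L ++ L') = clauseWords L ++ clauseWords L' := by simp [clauseWords]

theorem length_clauseWords_le {L : List (List Lit)} (h : IsTwoList L) :
    (clauseWords L).length ≤ 3 * L.length := by
  induction L with
  | nil => simp [clauseWords]
  | cons C L ih =>
    have := ih fun C hC => h C (by simp [hC])
    have h2 : C.length ≤ 2 := by
      rcases h C (by simp) with ⟨p, rfl⟩ | ⟨p, q, -, rfl⟩ <;> simp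
    simp only [clauseWords, List.flatMap_cons, List.length_append, List.length_cons,
      List.length_map] at *
    omega

theorem encode_getD_append {L₁ L₂ : List (List Lit)} (C : List Lit) {k : ℕ} (hk : k ≤ C.length) :
    (encode (L₁ ++ C :: L₂)).getD (1 + (clauseWords L₁).length + k) 0 =
      (C.length :: C.map Lit.code).getD k 0 := by
  have : encode (L₁ ++ C :: L₂) = ((L₁ ++ C :: L₂).length :: clauseWords L₁) ++
      ((C.length :: C.map Lit.code) ++ clauseWords L₂) := by
    simp [encode, clauseWords]
  rw [this, List.getD_append_right _ _ _ _ (by simp; omega),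
    List.getD_append _ _ _ _ (by simp; omega)]
  congr 1
  simp
  omega

theorem Loaded.push_unit {m : ℕ} {L : List (List Lit)} {src : ℕ → ℕ} {s s' : State}
    (h : Loaded m L src s) (p : Lit)
    (hreg : ∀ i ∈ [0, 1, 3, 6], s'.reg i = s.reg i) (h5 : s'.reg 5 = s.reg 5 + 1)
    (harr : ∀ j ∈ [0, 1, 2, 3, 7], s'.arr j = s.arr j)
    (h6 : s'.arr 6 = Function.update (s.arr 6) (s.reg 5) p.code) :
    Loaded m (L ++ [[p]]) src s' := by
  simp only [List.mem_cons, List.not_mem_nil, or_false, forall_eq_or_imp, forall_eq] at hreg harr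
  obtain ⟨r0, r1, r3, r6⟩ := hreg
  obtain ⟨a0, a1, a2, a3, a7⟩ := harr
  constructor
  · rw [r0, h.answer]
  · rw [r1, h.output]
  · rw [r3, h.base]
  · simp [h5, h.units]
  · have := h.edges
    simp only [r6, h5, List.length_append, List.length_singleton]
    omega
  · have := h.total
    simp [r6, h5]
    omega
  · rw [r6, a0, a1]
    exact h.links
  · intro a b
    rw [r6, a2, h.edge_iff]
    simp [listImplies]
  · intro a
    rw [h5, h6]
    have := h.unit_iff a
    constructor
    · rintro ⟨i, hi, e⟩
      rw [Function.update_apply] at e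
      split_ifs at e with h'
      · exact ⟨p, by simp, e.symm⟩
      · obtain ⟨q, hq, e'⟩ := this.1 ⟨i, by omega, e⟩
        exact ⟨q, by simp [hq], e'⟩
    · rintro ⟨q, hq, e⟩
      rcases List.mem_append.1 hq with hq | hq
      · obtain ⟨i, hi, e'⟩ := this.2 ⟨q, hq, e⟩
        exact ⟨i, by omega, by rw [Function.update_of_ne (by omega), e']⟩
      · refine ⟨s.reg 5, by omega, ?_⟩
        have : q = p := by simpa using hq
        rw [Function.update_self, e, this]
  · rw [a3]
    exact h.seen
  · rw [a7]
    exact h.mark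

/-- The clause `{p, q}` contributes the two contrapositive edges, from the complement of `p` to `q`
and from the complement of `q` to `p`. -/
theorem Loaded.push_pair {m : ℕ} {L : List (List Lit)} {src : ℕ → ℕ} {s s' : State}
    (h : Loaded m L src s) (p q : Lit)
    (hreg : ∀ i ∈ [0, 1, 3, 5], s'.reg i = s.reg i) (h6 : s'.reg 6 = s.reg 6 + 1 + 1)
    (harr : ∀ j ∈ [3, 6, 7], s'.arr j = s.arr j)
    (h0 : s'.arr 0 = Function.update (Function.update (s.arr 0) p.compl.code (s.reg 6 + 1))
      q.compl.code (s.reg 6 + 1 + 1))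
    (h1 : s'.arr 1 = Function.update (Function.update (s.arr 1) (s.reg 6 + 1)
      (s.arr 0 p.compl.code)) (s.reg 6 + 1 + 1)
      (Function.update (s.arr 0) p.compl.code (s.reg 6 + 1) q.compl.code))
    (h2 : s'.arr 2 = Function.update (Function.update (s.arr 2) (s.reg 6 + 1) q.code)
      (s.reg 6 + 1 + 1) p.code) :
    Loaded m (L ++ [[p, q]]) (Function.update (Function.update src (s.reg 6 + 1) p.compl.code)
      (s.reg 6 + 1 + 1) q.compl.code) s' := by
  simp only [List.mem_cons, List.not_mem_nil, or_false, forall_eq_or_imp, forall_eq] at hreg harr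
  obtain ⟨r0, r1, r3, r5⟩ := hreg
  obtain ⟨a3, a6, a7⟩ := harr
  constructor
  · rw [r0, h.answer]
  · rw [r1, h.output]
  · rw [r3, h.base]
  · simp [r5, h.units]
  · have := h.edges
    simp only [h6, r5, List.length_append, List.length_singleton]
    omega
  · have := h.total
    simp [h6, r5]
    omega
  · rw [h6, h0, h1]
    exact (h.links.push _).push _
  · intro a b
    have := h.edge_iff a b
    rw [h6, h2]
    constructor
    · rintro ⟨i, hi1, hi2, ea, eb⟩
      rcases (by omega : i ≤ s.reg 6 ∨ i = s.reg 6 + 1 ∨ i = s.reg 6 + 1 + 1) with hi | rfl | rfl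
      · rw [Function.update_of_ne (by omega), Function.update_of_ne (by omega)] at ea eb
        obtain ⟨u, v, huv, e⟩ := this.1 ⟨i, hi1, hi, ea, eb⟩
        refine ⟨u, v, ?_, e⟩
        rcases huv with h | h
        · exact Or.inl (by simp [h])
        · exact Or.inr (by simp [h])
      · rw [Function.update_of_ne (by omega), Function.update_self] at ea eb
        exact ⟨p.compl, q, Or.inl (by simp), ea.symm, eb.symm⟩
      · rw [Function.update_self] at ea eb
        exact ⟨q.compl, p, Or.inr (by simp), ea.symm, eb.symm⟩
    · rintro ⟨u, v, huv, ea, eb⟩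
      by_cases hL : listImplies L u v
      · obtain ⟨i, hi1, hi2, ea, eb⟩ := this.2 ⟨u, v, hL, ea, eb⟩
        refine ⟨i, hi1, by omega, ?_, ?_⟩
        · rw [Function.update_of_ne (by omega), Function.update_of_ne (by omega), ea]
        · rw [Function.update_of_ne (by omega), Function.update_of_ne (by omega), eb]
      · simp only [listImplies, not_or] at hL
        simp only [listImplies, List.mem_append, hL, false_or, List.mem_singleton, List.cons.injEq,
          and_true] at huv
        rcases huv with ⟨rfl, rfl⟩ | ⟨rfl, rfl⟩
        · refine ⟨s.reg 6 + 1, by omega, by omega, ?_, ?_⟩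
          · rw [Function.update_of_ne (by omega), Function.update_self, ea, Lit.compl_compl]
          · rw [Function.update_of_ne (by omega), Function.update_self, eb]
        · refine ⟨s.reg 6 + 1 + 1, by omega, by omega, ?_, ?_⟩
          · rw [Function.update_self, ea, Lit.compl_compl]
          · rw [Function.update_self, eb]
  · intro a
    rw [r5, a6, h.unit_iff]
    simp
  · rw [a3]
    exact h.seen
  · rw [a7]
    exact h.mark

/-- The state of the loop of `scan`, with the clauses `L₁` read and `L₂` left. -/
structure Scanning (m : ℕ) (L₁ L₂ : List (List Lit)) (src : ℕ → ℕ) (s : State) : Prop where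
  loaded : Loaded m L₁ src s
  len : L₁.length + L₂.length = m
  left : s.reg 2 = L₂.length
  pos : s.reg 4 = 1 + (clauseWords L₁).length
  input : ∀ a < 8 * (2 * m + 1), s.mem a = (encode (L₁ ++ L₂)).getD a 0

theorem Scanning.step {m M : ℕ} {L₁ L₂ : List (List Lit)} {C : List Lit} {src : ℕ → ℕ} {s : State}
    (h : Scanning m L₁ (C :: L₂) src s) (hL : IsTwoList (L₁ ++ C :: L₂))
    (hM : ∀ D ∈ L₁ ++ C :: L₂, ∀ p ∈ D, p.code ≤ M) (hW : 32 * (m + M + 2) ≤ W) :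
    scanBody.wp W (fun s' => ∃ src', Scanning m (L₁ ++ [C]) L₂ src' s') s := by
  have hbase := h.loaded.base
  have hlen := h.len
  have hpos := h.pos
  have hleft := h.left
  have hedges := h.loaded.edges
  have hlinks := h.loaded.links
  have hcw := length_clauseWords_le (L := L₁) fun C hC => hL C (by simp [hC])
  simp only [List.length_cons] at hlen hleft
  have hread : ∀ k ≤ C.length, k ≤ 2 → s.mem (s.reg 4 + k) =
      (C.length :: C.map Lit.code).getD k 0 := by
    intro k hk hk2
    rw [h.input _ (by omega), hpos, encode_getD_append C hk]
  have hCL : L₁ ++ C :: L₂ = L₁ ++ [C] ++ L₂ := by simp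
  -- The postcondition is made opaque, so that `simp` only executes the program symbolically; it is
  -- restored by `← hQ`.
  generalize hQ : (fun s' => ∃ src', Scanning m (L₁ ++ [C]) L₂ src' s') = Q
  rcases hL C (by simp) with ⟨p, rfl⟩ | ⟨p, q, hpq, rfl⟩
  · have m0 := hread 0 (by simp) (by simp)
    have m1 := hread 1 (by simp) (by simp)
    have hp := hM [p] (by simp) p (by simp)
    simp only [add_zero, List.length_singleton, List.getD_cons_zero, List.getD_cons_succ,
      List.map_cons, List.map_nil] at m0 m1
    simp [scanBody, m0, m1]
    and_intros <;> try omega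
    rw [← hQ]
    refine ⟨src, h.loaded.push_unit p ?_ ?_ ?_ ?_, ?_, ?_, ?_, ?_⟩
    · simp
    · simp
    · simp
    · simp
    · simp; omega
    · simp; omega
    · simp [hpos, clauseWords]; omega
    · intro a ha
      simp only [State.mem_setReg]
      rw [State.mem_setArr _ (by simp; omega), ← hCL, ← h.input a ha]
      rfl
  · have m0 := hread 0 (by simp) (by simp)
    have m1 := hread 1 (by simp) (by simp)
    have m2 := hread 2 (by simp) (by simp)
    have hp := hM [p, q] (by simp) p (by simp)
    have hq := hM [p, q] (by simp) q (by simp)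
    simp only [add_zero, List.length_cons, List.length_nil, List.getD_cons_zero,
      List.getD_cons_succ, List.map_cons, List.map_nil] at m0 m1 m2
    have c1 := complCode_le p.code
    have c2 := complCode_le q.code
    rw [complCode_code] at c1 c2
    have hh1 := hlinks.head_le p.compl.code
    have hh2 := hlinks.head_le q.compl.code
    have hh3 : Function.update (s.arr 0) p.compl.code (s.reg 6 + 1) q.compl.code ≤
        s.reg 6 + 1 := by
      rw [Function.update_apply]
      split_ifs <;> omega
    simp [scanBody, m0, m1, m2]
    and_intros <;> try omega
    rw [← hQ]
    refine ⟨_, h.loaded.push_pair p q ?_ ?_ ?_ ?_ ?_ ?_, ?_, ?_, ?_, ?_⟩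
    · simp
    · simp
    · simp
    · simp
    · simp
    · simp
    · simp; omega
    · simp; omega
    · simp [hpos, clauseWords]; omega
    · intro a ha
      have ha' : a < s.reg 3 := by omega
      simp only [State.mem_setReg]
      -- The six array stores lie above the base and leave the input intact.
      iterate 6
        rw [State.mem_setArr _ (by simpa using ha')]
        try simp only [State.mem_setReg]
      rw [← hCL, ← h.input a ha]

theorem scan_runs {m M : ℕ} {L : List (List Lit)} (hm : m = L.length) (hL : IsTwoList L)
    (hM : ∀ C ∈ L, ∀ p ∈ C, p.code ≤ M) (hW : 32 * (m + M + 2) ≤ W) :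
    Runs W scan (initState L)
      (scanInit.cost + (m + 1) * ((Test.lt (.const 0) (.reg 2)).cost + 1 + scanBody.cost))
      fun s => ∃ src, Loaded m L src s := by
  refine Runs.seq (Q := fun s => ∃ src, Scanning m [] L src s) ?_ ?_
  · refine Program.wp_runs ?_
    generalize hQ : (fun s => ∃ src, Scanning m [] L src s) = Q
    have h0 : (initState L).mem 0 = m := by simp [initState, encode, hm]
    have hreg : (initState L).reg = fun _ => 0 := rfl
    have hcw := length_clauseWords_le hL
    have hmem : ∀ a, m * 3 < a → (initState L).mem a = 0 := by
      intro a ha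
      refine List.getD_eq_default _ _ ?_
      simp only [encode, List.length_cons]
      simp only [clauseWords] at hcw
      omega
    simp [scanInit, h0]
    and_intros <;> try omega
    rw [← hQ]
    refine ⟨fun _ => 0, ⟨?_, ?_, ?_, ?_, ?_, ?_, ?_, ?_, ?_, ?_, ?_⟩, ?_, ?_, ?_, ?_⟩
    · simp [hreg]
    · simp [hreg]
    · simp; omega
    · simp [hreg]
    · simp [hreg]
    · simp [hreg]
    · constructor <;> simp [hreg, State.arr]
      · intro a; rw [hmem _ (by omega)]
      · intro a h; exact absurd (hmem _ (by omega)) h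
      · intros; omega
      · intros; omega
      · intros; omega
    · intro a b
      simp [hreg, listImplies]
    · intro a
      simp [hreg]
    · intro i
      simp only [State.arr]
      simpa using hmem _ (by omega)
    · intro i
      simp only [State.arr]
      simpa using hmem _ (by omega)
    · simp [hm]
    · simp [hm]
    · simp [clauseWords]
    · intro a ha
      simp [initState]
  · rintro s ⟨src, hs⟩
    let I : ℕ → State → Prop := fun n s => ∃ L₁ L₂ src, L₁ ++ L₂ = L ∧ n = L₂.length ∧
      Scanning m L₁ L₂ src s
    refine Runs.loop (I := I) ?_ ?_ ⟨[], L, src, rfl, hm, hs⟩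
    · rintro n s ⟨L₁, L₂, src, rfl, rfl, h⟩ hb
      cases L₂ with
      | nil => simp [h.left] at hb
      | cons C L₂ =>
        refine (Program.wp_runs (h.step (M := M) hL hM hW)).mono le_rfl ?_
        rintro s' ⟨src', h'⟩
        exact ⟨_, by simp, L₁ ++ [C], L₂, src', by simp, rfl, h'⟩
    · rintro n s ⟨L₁, L₂, src, rfl, rfl, h⟩ hb
      have : L₂ = [] := by simpa [h.left] using hb
      subst this
      refine ⟨src, ?_⟩
      simpa using h.loaded

/-! ### Breadth-first search -/

section Search

/-- The search from `x`, in the round `r`, is at the edge `e` (if not `0`) with source `p`; the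
first `qh` of the `qt` literals in the queue have been removed from it, and `D` is the set of
edges used. -/
structure Search (K : ℕ) (src tgt : ℕ → ℕ) (r x : ℕ) (seen par queue : ℕ → ℕ) (qh qt e p : ℕ)
    (D : Finset ℕ) : Prop where
  pos : 0 < qt
  start : queue 0 = x
  le : qh ≤ qt
  seen_iff : ∀ a, seen a = r ↔ ∃ i < qt, queue i = a
  seen_le : ∀ a, seen a ≤ r
  inj : ∀ i j, i < qt → j < qt → queue i = queue j → i = j
  parent : ∀ i, 0 < i → i < qt → ∃ j < i, par (queue i) = queue j ∧
    ∃ k, 1 ≤ k ∧ k ≤ K ∧ src k = queue j ∧ tgt k = queue i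
  cur : e ≠ 0 → 0 < qh ∧ e ≤ K ∧ src e = p ∧ p = queue (qh - 1)
  mem_iff : ∀ k, k ∈ D ↔ 1 ≤ k ∧ k ≤ K ∧ ∃ i < qh, queue i = src k ∧ (i + 1 = qh → e < k)
  seen_tgt : ∀ k ∈ D, seen (tgt k) = r
  qt_le : qt ≤ D.card + 1

variable {K : ℕ} {src tgt head next : ℕ → ℕ} {r x : ℕ} {seen par queue : ℕ → ℕ}
  {qh qt e p : ℕ} {D : Finset ℕ}

theorem Search.card_le (h : Search K src tgt r x seen par queue qh qt e p D) : D.card ≤ K := by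
  have : D ⊆ Finset.Icc 1 K := fun k hk => by
    have := (h.mem_iff k).1 hk
    simp [this.1, this.2.1]
  simpa using Finset.card_le_card this

theorem Search.init (hseen : ∀ a, seen a < r) (hq : queue 0 = x) :
    Search K src tgt r x (Function.update seen x r) par queue 0 1 0 p ∅ := by
  constructor
  · exact Nat.one_pos
  · exact hq
  · exact Nat.zero_le _
  · intro a
    have := (hseen a).ne
    grind [Function.update_apply]
  · intro a
    have := (hseen a).le
    grind [Function.update_apply]
  · intros; omega
  · intros; omega
  · simp
  · simp
  · simp
  · simp

/-- The set of used edges stays the same: with `e = 0` the previous literal is exhausted, and no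
edge of the new one has a number above its head. -/
theorem Search.pop (hl : Links K src head next)
    (h : Search K src tgt r x seen par queue qh qt 0 p D) (hlt : qh < qt) :
    Search K src tgt r x seen par queue (qh + 1) qt (head (queue qh)) (queue qh) D := by
  refine ⟨h.pos, h.start, hlt, h.seen_iff, h.seen_le, h.inj, h.parent, fun he => ?_, fun k => ?_,
    h.seen_tgt, h.qt_le⟩
  · exact ⟨by omega, hl.head_le _, hl.head_src _ he, by simp⟩
  · rw [h.mem_iff]
    refine and_congr_right fun h1 => and_congr_right fun h2 => ⟨?_, ?_⟩
    · rintro ⟨i, hi, e, -⟩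
      exact ⟨i, by omega, e, fun _ => by omega⟩
    · rintro ⟨i, hi, e, h'⟩
      rcases Nat.lt_or_ge i qh with hi' | hi'
      · exact ⟨i, hi', e, fun _ => by omega⟩
      · obtain rfl : i = qh := by omega
        exact absurd e.symm (hl.head_max _ _ (h' rfl) h2)

/-- Every edge is used only once; this makes the search linear in the number of edges. -/
theorem Search.notMem (h : Search K src tgt r x seen par queue qh qt e p D) (he : e ≠ 0) :
    e ∉ D := by
  intro hD
  obtain ⟨-, -, i, hi, h1, h2⟩ := (h.mem_iff e).1 hD
  obtain ⟨c1, c2, c3, c4⟩ := h.cur he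
  have hle := h.le
  have := h.inj i (qh - 1) (by omega) (by omega) (by rw [h1, c3, c4])
  have := h2 (by omega)
  omega

/-- No edge with the same source lies strictly between `next e` and `e`, so lowering the bound from
`e` to `next e` adds exactly `e`. -/
theorem Search.mem_insert_iff (hl : Links K src head next)
    (h : Search K src tgt r x seen par queue qh qt e p D) (he : e ≠ 0) (k : ℕ) :
    k ∈ insert e D ↔
      1 ≤ k ∧ k ≤ K ∧ ∃ i < qh, queue i = src k ∧ (i + 1 = qh → next e < k) := by
  obtain ⟨c1, c2, c3, c4⟩ := h.cur he
  have hlt := hl.next_lt e (by omega) c2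
  rw [Finset.mem_insert, h.mem_iff]
  constructor
  · rintro (rfl | ⟨h1, h2, i, hi, h3, h4⟩)
    · exact ⟨by omega, c2, qh - 1, by omega, by rw [c3, c4], fun _ => hlt⟩
    · exact ⟨h1, h2, i, hi, h3, fun hi' => hlt.trans (h4 hi')⟩
  · rintro ⟨h1, h2, i, hi, h3, h4⟩
    by_cases hi' : i + 1 = qh
    · have h4 := h4 hi'
      have hi'' : i = qh - 1 := by omega
      rcases Nat.lt_trichotomy k e with hk | hk | hk
      · refine absurd ?_ (hl.next_max e k c2 h4 hk)
        rw [← h3, c3, c4, hi'']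
      · exact Or.inl hk
      · exact Or.inr ⟨h1, h2, i, hi, h3, fun _ => hk⟩
    · exact Or.inr ⟨h1, h2, i, hi, h3, fun h => absurd h hi'⟩

theorem Search.skip (hl : Links K src head next)
    (h : Search K src tgt r x seen par queue qh qt e p D) (he : e ≠ 0) (hs : seen (tgt e) = r) :
    Search K src tgt r x seen par queue qh qt (next e) p (insert e D) := by
  obtain ⟨c1, c2, c3, c4⟩ := h.cur he
  refine ⟨h.pos, h.start, h.le, h.seen_iff, h.seen_le, h.inj, h.parent, fun he' => ?_,
    h.mem_insert_iff hl he, fun k hk => ?_, ?_⟩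
  · have := hl.next_lt e (by omega) c2
    exact ⟨c1, by omega, by rw [hl.next_src e (by omega) c2 he', c3], c4⟩
  · rcases Finset.mem_insert.1 hk with rfl | hk
    · exact hs
    · exact h.seen_tgt k hk
  · rw [Finset.card_insert_of_notMem (h.notMem he)]
    have := h.qt_le
    omega

/-- The parent is the literal removed last from the queue, which precedes the new entry. Queue and
set of used edges both grow by one, so `qt_le` persists. -/
theorem Search.push (hl : Links K src head next)
    (h : Search K src tgt r x seen par queue qh qt e p D) (he : e ≠ 0) (hs : seen (tgt e) ≠ r) :
    Search K src tgt r x (Function.update seen (tgt e) r) (Function.update par (tgt e) p)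
      (Function.update queue qt (tgt e)) qh (qt + 1) (next e) p (insert e D) := by
  obtain ⟨c1, c2, c3, c4⟩ := h.cur he
  have hle := h.le
  have hq : ∀ i < qt, Function.update queue qt (tgt e) i = queue i := fun i hi =>
    Function.update_of_ne (by omega) ..
  have hnew : ∀ i < qt, queue i ≠ tgt e := fun i hi e' => hs ((h.seen_iff _).2 ⟨i, hi, e'⟩)
  refine ⟨by omega, ?_, by omega, fun a => ?_, fun a => ?_, fun i j hi hj e' => ?_,
    fun i h0 hi => ?_, fun he' => ?_, fun k => ?_, fun k hk => ?_, ?_⟩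
  · rw [hq 0 h.pos, h.start]
  · rw [Function.update_apply]
    constructor
    · intro ha
      split_ifs at ha with h'
      · exact ⟨qt, by omega, by rw [Function.update_self, h']⟩
      · obtain ⟨i, hi, e'⟩ := (h.seen_iff a).1 ha
        exact ⟨i, by omega, by rw [hq i hi, e']⟩
    · rintro ⟨i, hi, e'⟩
      split_ifs with h'
      · rfl
      · rcases Nat.lt_succ_iff_lt_or_eq.1 hi with hi | rfl
        · rw [hq i hi] at e'
          exact (h.seen_iff a).2 ⟨i, hi, e'⟩
        · rw [Function.update_self] at e'
          exact absurd e'.symm h'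
  · rw [Function.update_apply]
    split_ifs
    · exact le_rfl
    · exact h.seen_le a
  · rcases Nat.lt_succ_iff_lt_or_eq.1 hi with hi | rfl <;>
      rcases Nat.lt_succ_iff_lt_or_eq.1 hj with hj | rfl
    · rw [hq i hi, hq j hj] at e'
      exact h.inj i j hi hj e'
    · rw [hq i hi, Function.update_self] at e'
      exact absurd e' (hnew i hi)
    · rw [hq j hj, Function.update_self] at e'
      exact absurd e'.symm (hnew j hj)
    · rfl
  · rcases Nat.lt_succ_iff_lt_or_eq.1 hi with hi | rfl
    · obtain ⟨j, hj, h1, k, h2, h3, h4, h5⟩ := h.parent i h0 hi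
      refine ⟨j, hj, ?_, k, h2, h3, ?_, ?_⟩
      · rw [hq i hi, hq j (by omega), Function.update_of_ne (hnew i hi), h1]
      · rw [hq j (by omega), h4]
      · rw [hq i hi, h5]
    · refine ⟨qh - 1, by omega, ?_, e, by omega, c2, ?_, ?_⟩
      · rw [Function.update_self, Function.update_self, hq _ (by omega), c4]
      · rw [hq _ (by omega), c3, c4]
      · rw [Function.update_self]
  · have := hl.next_lt e (by omega) c2
    exact ⟨c1, by omega, by rw [hl.next_src e (by omega) c2 he', c3], by rw [hq _ (by omega), c4]⟩
  · rw [h.mem_insert_iff hl he]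
    refine and_congr_right fun _ => and_congr_right fun _ => exists_congr fun i =>
      and_congr_right fun hi => ?_
    rw [hq i (by omega)]
  · rw [Function.update_apply]
    split_ifs with h'
    · rfl
    · rcases Finset.mem_insert.1 hk with rfl | hk
      · exact absurd rfl h'
      · exact h.seen_tgt k hk
  · rw [Finset.card_insert_of_notMem (h.notMem he)]
    have := h.qt_le
    omega

/-- The result of a search: a tree of `n` literals with the root `x`. -/
structure SearchTree (K : ℕ) (src tgt : ℕ → ℕ) (r x : ℕ) (seen par queue : ℕ → ℕ) (n : ℕ) :
    Prop where
  pos : 0 < n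
  le : n ≤ K + 1
  start : queue 0 = x
  seen_iff : ∀ a, seen a = r ↔ ∃ i < n, queue i = a
  seen_le : ∀ a, seen a ≤ r
  inj : ∀ i j, i < n → j < n → queue i = queue j → i = j
  parent : ∀ i, 0 < i → i < n → ∃ j < i, par (queue i) = queue j ∧
    ∃ k, 1 ≤ k ∧ k ≤ K ∧ src k = queue j ∧ tgt k = queue i
  closed : ∀ k, 1 ≤ k → k ≤ K → seen (src k) = r → seen (tgt k) = r

theorem Search.tree (h : Search K src tgt r x seen par queue qt qt 0 p D) :
    SearchTree K src tgt r x seen par queue qt := by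
  refine ⟨h.pos, ?_, h.start, h.seen_iff, h.seen_le, h.inj, h.parent, fun k h1 h2 hk => ?_⟩
  · have := h.card_le
    have := h.qt_le
    omega
  · obtain ⟨i, hi, e⟩ := (h.seen_iff _).1 hk
    exact h.seen_tgt k ((h.mem_iff k).2 ⟨h1, h2, i, hi, e, fun _ => by omega⟩)

/-- Following parents leads back to the root; conversely the set of seen literals contains the root
and is closed under edges. -/
theorem SearchTree.seen_iff_reaches {n : ℕ} (h : SearchTree K src tgt r x seen par queue n)
    (a : ℕ) : seen a = r ↔
      Relation.ReflTransGen (fun a b => ∃ i, 1 ≤ i ∧ i ≤ K ∧ src i = a ∧ tgt i = b) x a := by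
  constructor
  · intro ha
    obtain ⟨i, hi, rfl⟩ := (h.seen_iff a).1 ha
    clear ha
    induction i using Nat.strong_induction_on with
    | _ i ih =>
      rcases Nat.eq_zero_or_pos i with rfl | h0
      · rw [h.start]
      · obtain ⟨j, hj, -, hk⟩ := h.parent i h0 hi
        exact (ih j hj (by omega)).tail hk
  · intro ha
    induction ha with
    | refl => exact (h.seen_iff _).2 ⟨0, h.pos, h.start⟩
    | tail _ hk ih =>
      obtain ⟨k, h1, h2, rfl, rfl⟩ := hk
      exact h.closed k h1 h2 ih

/-- `s` agrees with `s₀` in the answer, the base, the numbers of units and edges, and in the arrays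
that are constant while searching. -/
structure Frame (s₀ s : State) : Prop where
  reg : ∀ i ∈ [0, 1, 3, 5, 6], s.reg i = s₀.reg i
  arr : ∀ j ∈ [0, 1, 2, 6, 7], s.arr j = s₀.arr j

/-- Register `9` is the stamp of the round and `10` the root; `11` and `12` delimit the queue, `13`
is the current edge and `14` its source. The arrays `3`, `4`, `5` hold stamps, parents and queue. -/
def searchInit : Program :=
  .storeAt 3 (.reg 10) (.reg 9) ;;
  .storeAt 5 (.const 0) (.reg 10) ;;
  .assign 11 (.const 0) ;;
  .assign 12 (.const 1) ;;
  .assign 13 (.const 0)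

/-- Takes the next literal from the queue, or uses the next edge. -/
def searchBody : Program :=
  .branch (.eq (.reg 13) (.const 0))
    (.assign 14 (.get 5 (.reg 11)) ;;
     .assign 11 (.add (.reg 11) (.const 1)) ;;
     .assign 13 (.get 0 (.reg 14)))
    (.assign 15 (.get 2 (.reg 13)) ;;
     .branch (.eq (.get 3 (.reg 15)) (.reg 9))
       .skip
       (.storeAt 3 (.reg 15) (.reg 9) ;;
        .storeAt 4 (.reg 15) (.reg 14) ;;
        .storeAt 5 (.reg 12) (.reg 15) ;;
        .assign 12 (.add (.reg 12) (.const 1))) ;;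
     .assign 13 (.get 1 (.reg 13)))

def searchTest : Test := .lt (.const 0) (.add (.reg 13) (.sub (.reg 12) (.reg 11)))

def search : Program := searchInit ;; .loop searchTest searchBody

/-- The invariant of the loop of `search`. -/
def Searching (s₀ : State) (src : ℕ → ℕ) (r x n : ℕ) (s : State) : Prop :=
  Frame s₀ s ∧ s.reg 9 = r ∧ s.reg 10 = x ∧ ∃ D,
    Search (s₀.reg 6) src (s₀.arr 2) r x (s.arr 3) (s.arr 4) (s.arr 5) (s.reg 11) (s.reg 12)
      (s.reg 13) (s.reg 14) D ∧ n = 2 * (s₀.reg 6 - D.card) + (s.reg 12 - s.reg 11)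

/-- The measure counts an unused edge twice and a waiting literal once: using an edge may add a
literal to the queue, yet the measure still drops. -/
theorem Searching.step {s₀ s : State} {M N n : ℕ} (hl : Links (s₀.reg 6) src (s₀.arr 0) (s₀.arr 1))
    (ht : ∀ i, 1 ≤ i → i ≤ s₀.reg 6 → s₀.arr 2 i ≤ M) (hK : s₀.reg 6 ≤ N) (hx : x ≤ M)
    (hr : r ≤ N)
    (hW : s₀.reg 3 + 8 * (M + N + 2) ≤ W) (h : Searching s₀ src r x n s)
    (hb : searchTest.Holds s) :
    searchBody.wp W (fun s' => ∃ n' < n, Searching s₀ src r x n' s') s := by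
  obtain ⟨hf, h9, h10, D, hs, hn⟩ := h
  have hcard := hs.card_le
  have hqt := hs.qt_le
  have hle := hs.le
  have hqueue : ∀ i < s.reg 12, s.arr 5 i ≤ M := by
    intro i hi
    rcases Nat.eq_zero_or_pos i with rfl | h0
    · rw [hs.start]; exact hx
    · obtain ⟨j, -, -, k, h1, h2, -, h3⟩ := hs.parent i h0 hi
      rw [← h3]
      exact ht k h1 h2
  have hf0 := hf
  obtain ⟨hreg, harr⟩ := hf
  simp only [List.mem_cons, List.not_mem_nil, or_false, forall_eq_or_imp, forall_eq] at hreg harr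
  obtain ⟨r0, r1, r3, r5, r6⟩ := hreg
  obtain ⟨a0, a1, a2, a6, a7⟩ := harr
  simp only [searchTest, Test.holds_lt, RExpr.eval_const, RExpr.eval_add, RExpr.eval_reg,
    RExpr.eval_sub] at hb
  generalize hQ : (fun s' => ∃ n' < n, Searching s₀ src r x n' s') = Q
  by_cases he : s.reg 13 = 0
  · have hpop := Search.pop hl (he ▸ hs) (by omega)
    have := hqueue (s.reg 11) (by omega)
    have := hl.head_le (s.arr 5 (s.reg 11))
    simp [searchBody, he]
    rw [a0]
    and_intros <;> try omega
    rw [← hQ]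
    refine ⟨_, ?_, ⟨?_, ?_⟩, ?_, ?_, D, ?_, rfl⟩
    · simp
      omega
    · simp [r0, r1, r3, r5, r6]
    · simp [a0, a1, a2, a6, a7]
    · simpa using h9
    · simpa using h10
    · simpa using hpop
  · obtain ⟨c1, c2, c3, c4⟩ := hs.cur he
    have htM := ht (s.reg 13) (by omega) c2
    have hnlt := hl.next_lt (s.reg 13) (by omega) c2
    have hp := hqueue (s.reg 11 - 1) (by omega)
    have hins := Finset.card_insert_of_notMem (hs.notMem he)
    rw [← c4] at hp
    by_cases hseen : s.arr 3 (s₀.arr 2 (s.reg 13)) = r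
    · have hskip := Search.skip hl hs he hseen
      have hcard' := hskip.card_le
      simp [searchBody, he, a2, h9, hseen]
      rw [a1]
      and_intros <;> try omega
      rw [← hQ]
      refine ⟨_, ?_, ⟨?_, ?_⟩, ?_, ?_, insert (s.reg 13) D, ?_, rfl⟩
      rotate_right
      · simpa using hskip
      · simp
        omega
      · simp [r0, r1, r3, r5, r6]
      · simp [a0, a1, a2, a6, a7]
      · simpa using h9
      · simpa using h10
    · have hpush := Search.push hl hs he hseen
      have hcard' := hpush.card_le
      simp [searchBody, he, a2, h9, hseen]
      rw [a1]
      and_intros <;> try omega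
      rw [← hQ]
      refine ⟨_, ?_, ⟨?_, ?_⟩, ?_, ?_, insert (s.reg 13) D, ?_, rfl⟩
      rotate_right
      · simpa using hpush
      · simp
        omega
      · simp [r0, r1, r3, r5, r6]
      · simp [a0, a1, a2, a6, a7]
      · simpa using h9
      · simpa using h10

theorem search_runs {s₀ s : State} {M N : ℕ} (hl : Links (s₀.reg 6) src (s₀.arr 0) (s₀.arr 1))
    (ht : ∀ i, 1 ≤ i → i ≤ s₀.reg 6 → s₀.arr 2 i ≤ M) (hK : s₀.reg 6 ≤ N) (hx : x ≤ M)
    (hr : r ≤ N) (hW : s₀.reg 3 + 8 * (M + N + 2) ≤ W) (hf : Frame s₀ s) (h9 : s.reg 9 = r)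
    (h10 : s.reg 10 = x) (hseen : ∀ a, s.arr 3 a < r) :
    Runs W search s
      (searchInit.cost + (2 * s₀.reg 6 + 1 + 1) * (searchTest.cost + 1 + searchBody.cost))
      fun s' => Frame s₀ s' ∧ s'.reg 9 = r ∧ s'.reg 10 = x ∧
        ∃ n, SearchTree (s₀.reg 6) src (s₀.arr 2) r x (s'.arr 3) (s'.arr 4) (s'.arr 5) n := by
  -- Initially all edges are unused and only the root is waiting.
  refine Runs.seq (Q := Searching s₀ src r x (2 * s₀.reg 6 + 1)) ?_ fun s' hs' =>
    Runs.loop (I := Searching s₀ src r x)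
      (fun n s h hb => Program.wp_runs (h.step hl ht hK hx hr hW hb)) ?_ hs'
  · refine Program.wp_runs ?_
    obtain ⟨hreg, harr⟩ := hf
    simp only [List.mem_cons, List.not_mem_nil, or_false, forall_eq_or_imp, forall_eq] at hreg harr
    obtain ⟨r0, r1, r3, r5, r6⟩ := hreg
    obtain ⟨a0, a1, a2, a6, a7⟩ := harr
    generalize hQ : Searching s₀ src r x (2 * s₀.reg 6 + 1) = Q
    simp [searchInit, h9, h10]
    and_intros <;> try omega
    rw [← hQ]
    refine ⟨⟨?_, ?_⟩, ?_, ?_, ∅, ?_, ?_⟩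
    · simp [r0, r1, r3, r5, r6]
    · simp [a0, a1, a2, a6, a7]
    · simpa using h9
    · simpa using h10
    · simpa using Search.init hseen (by simp)
    · simp
  · rintro n s ⟨hf, h9, h10, D, hs, -⟩ hb
    refine ⟨hf, h9, h10, s.reg 12, ?_⟩
    have hle := hs.le
    simp only [searchTest, Test.holds_lt, RExpr.eval_const, RExpr.eval_add, RExpr.eval_reg,
      RExpr.eval_sub] at hb
    have h1 : s.reg 13 = 0 := by omega
    have h2 : s.reg 11 = s.reg 12 := by omega
    rw [h1, h2] at hs
    exact hs.tree

end Search

/-! ### Searching from all unit-clauses -/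

section Rounds

variable {src : ℕ → ℕ} {r x : ℕ}

/-- Looks whether the complement of the next unit literal has been reached. Only the unit literals
equal to register `c` are considered, which means all of them for `c = 17`, and only the root of
the search for `c = 10`. On success, the number of units is set to `0` to leave the loops. -/
def checkBody (c : ℕ) : Program :=
  .assign 17 (.get 6 (.reg 16)) ;;
  .assign 16 (.add (.reg 16) (.const 1)) ;;
  .branch (.eq (.reg 17) (.reg c))
    (.branch (.eq (.get 3 (.compl (.reg 17))) (.reg 9))
      (.assign 0 (.const 1) ;; .assign 5 (.const 0))
      .skip)
    .skip

def checkTest : Test := .lt (.reg 16) (.reg 5)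

def roundInit : Program :=
  .assign 10 (.get 6 (.reg 9)) ;; .assign 9 (.add (.reg 9) (.const 1))

/-- Searches from the next unit literal. -/
def round (c : ℕ) : Program :=
  roundInit ;; search ;; .assign 16 (.const 0) ;; .loop checkTest (checkBody c)

def roundTest : Test := .lt (.reg 9) (.reg 5)

def rounds (c : ℕ) : Program := .assign 9 (.const 0) ;; .loop roundTest (round c)

def edgeRel (s₀ : State) (src : ℕ → ℕ) (a b : ℕ) : Prop :=
  ∃ i, 1 ≤ i ∧ i ≤ s₀.reg 6 ∧ src i = a ∧ s₀.arr 2 i = b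

/-- The search from the literal in register `10` has reached the complement of the literal in
register `17`. -/
structure Found (s₀ : State) (src : ℕ → ℕ) (c : ℕ) (s : State) : Prop where
  answer : s.reg 0 = 1
  output : s.reg 1 = s₀.reg 1
  base : s.reg 3 = s₀.reg 3
  finished : s.reg 5 = 0
  mark : s.arr 7 = s₀.arr 7
  unit_x : ∃ i < s₀.reg 5, s₀.arr 6 i = s.reg 10
  unit_y : ∃ i < s₀.reg 5, s₀.arr 6 i = s.reg 17
  same : c = 10 → s.reg 17 = s.reg 10
  tree : ∃ r n, SearchTree (s₀.reg 6) src (s₀.arr 2) r (s.reg 10) (s.arr 3) (s.arr 4) (s.arr 5) n ∧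
    s.arr 3 (complCode (s.reg 17)) = r

/-- The invariant of the loop that looks for a reached complement of a unit literal. -/
def Checking (s₀ : State) (src : ℕ → ℕ) (c r x n : ℕ) (s : State) : Prop :=
  (Frame s₀ s ∧ s.reg 9 = r ∧ s.reg 10 = x ∧ n = s₀.reg 5 - s.reg 16 ∧
    (∃ m, SearchTree (s₀.reg 6) src (s₀.arr 2) r x (s.arr 3) (s.arr 4) (s.arr 5) m) ∧
    ∀ i < s.reg 16, (c = 10 → s₀.arr 6 i = x) → s.arr 3 (complCode (s₀.arr 6 i)) ≠ r) ∨
  (Found s₀ src c s ∧ n = 0)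

theorem Checking.step {s₀ s : State} {c M N n : ℕ} (hc : c = 10 ∨ c = 17) (hN : s₀.reg 5 ≤ N)
    (hU : ∀ i < s₀.reg 5, s₀.arr 6 i ≤ M) (hx : ∃ i < s₀.reg 5, s₀.arr 6 i = x)
    (hW : M + N + 1 ≤ W)
    (h : Checking s₀ src c r x n s) (hb : checkTest.Holds s) :
    (checkBody c).wp W (fun s' => ∃ n' < n, Checking s₀ src c r x n' s') s := by
  simp only [checkTest, Test.holds_lt, RExpr.eval_reg] at hb
  rcases h with ⟨hf, h9, h10, hn, ⟨m, ht⟩, hno⟩ | ⟨hF, -⟩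
  swap
  · rw [hF.finished] at hb
    omega
  obtain ⟨hreg, harr⟩ := hf
  simp only [List.mem_cons, List.not_mem_nil, or_false, forall_eq_or_imp, forall_eq] at hreg harr
  obtain ⟨r0, r1, r3, r5, r6⟩ := hreg
  obtain ⟨a0, a1, a2, a6, a7⟩ := harr
  have hle := hU (s.reg 16) (by omega)
  generalize hQ : (fun s' => ∃ n' < n, Checking s₀ src c r x n' s') = Q
  -- The two outcomes of a check, "continue" and "found", are treated uniformly in `c`; the two
  -- programs are distinguished only afterwards.
  have hcont : ((c = 10 → s₀.arr 6 (s.reg 16) = x) →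
        s.arr 3 (complCode (s₀.arr 6 (s.reg 16))) ≠ r) →
      Q ((s.setReg 17 (s₀.arr 6 (s.reg 16))).setReg 16 (s.reg 16 + 1)) := by
    intro hnew
    rw [← hQ]
    refine ⟨s₀.reg 5 - (s.reg 16 + 1), by omega, Or.inl ⟨⟨?_, ?_⟩, ?_, ?_, ?_, ⟨m, ?_⟩, ?_⟩⟩
    · simp [r0, r1, r3, r5, r6]
    · simp [a0, a1, a2, a6, a7]
    · simpa using h9
    · simpa using h10
    · simp
    · simpa using ht
    · simp only [State.reg_setReg, if_true]
      intro i hi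
      rcases Nat.lt_succ_iff_lt_or_eq.1 hi with hi | rfl
      · simpa using hno i hi
      · simpa using hnew
  have hfound : (c = 10 → s₀.arr 6 (s.reg 16) = x) →
        s.arr 3 (complCode (s₀.arr 6 (s.reg 16))) = r →
      Q ((((s.setReg 17 (s₀.arr 6 (s.reg 16))).setReg 16 (s.reg 16 + 1)).setReg 0 1).setReg 5 0) := by
    intro h1 h2
    rw [← hQ]
    refine ⟨0, by omega, Or.inr ⟨⟨?_, ?_, ?_, ?_, ?_, ?_, ?_, ?_, r, m, ?_, ?_⟩, rfl⟩⟩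
    · simp
    · simp [r1]
    · simp [r3]
    · simp
    · simp [a7]
    · simpa [h10] using hx
    · simpa using ⟨s.reg 16, by omega, rfl⟩
    · simpa [h10] using h1
    · simpa [h10] using ht
    · simpa using h2
  rcases hc with rfl | rfl
  · simp [checkBody, a6, h9, h10]
    exact ⟨by omega, by omega, fun h1 => ⟨fun h2 => ⟨by omega, hfound (fun _ => h1) h2⟩,
      fun h2 => hcont fun _ => h2⟩, fun h1 => hcont fun h3 => absurd (h3 rfl) h1⟩
  · simp [checkBody, a6, h9]
    exact ⟨by omega, by omega, fun h2 => ⟨by omega, hfound (by simp) h2⟩,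
      fun h2 => hcont fun _ => h2⟩

/-- The invariant of the loop over the unit literals. -/
def Rounds (s₀ : State) (src : ℕ → ℕ) (c n : ℕ) (s : State) : Prop :=
  (Frame s₀ s ∧ n = s₀.reg 5 - s.reg 9 ∧ (∀ a, s.arr 3 a ≤ s.reg 9) ∧
    ∀ i < s.reg 9, ∀ j < s₀.reg 5, (c = 10 → s₀.arr 6 j = s₀.arr 6 i) →
      ¬ Relation.ReflTransGen (edgeRel s₀ src) (s₀.arr 6 i) (complCode (s₀.arr 6 j))) ∨
  (Found s₀ src c s ∧ n = 0)

def searchCost (K : ℕ) : ℕ :=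
  searchInit.cost + (2 * K + 1 + 1) * (searchTest.cost + 1 + searchBody.cost)

def roundCost (c K u : ℕ) : ℕ :=
  roundInit.cost + (searchCost K + ((Program.assign 16 (.const 0)).cost +
    (u + 1) * (checkTest.cost + 1 + (checkBody c).cost)))

/-- The round for the unit number `i` has the stamp `i + 1`, so the initial zeros and all earlier
stamps count as unseen. A failed check of all units becomes a statement on reachability by
`seen_iff_reaches`. -/
theorem Rounds.step {s₀ s : State} {c M N n : ℕ} (hc : c = 10 ∨ c = 17) (hN : s₀.reg 5 ≤ N)
    (hU : ∀ i < s₀.reg 5, s₀.arr 6 i ≤ M)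
    (hl : Links (s₀.reg 6) src (s₀.arr 0) (s₀.arr 1))
    (ht : ∀ i, 1 ≤ i → i ≤ s₀.reg 6 → s₀.arr 2 i ≤ M) (hK : s₀.reg 6 ≤ N)
    (hW : s₀.reg 3 + 8 * (M + N + 2) ≤ W) (h : Rounds s₀ src c n s) (hb : roundTest.Holds s) :
    Runs W (round c) s (roundCost c (s₀.reg 6) (s₀.reg 5))
      (fun s' => ∃ n' < n, Rounds s₀ src c n' s') := by
  simp only [roundTest, Test.holds_lt, RExpr.eval_reg] at hb
  rcases h with ⟨hf, hn, hseen, hno⟩ | ⟨hF, -⟩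
  swap
  · rw [hF.finished] at hb
    omega
  have hf' := hf
  obtain ⟨hreg, harr⟩ := hf
  simp only [List.mem_cons, List.not_mem_nil, or_false, forall_eq_or_imp, forall_eq] at hreg harr
  obtain ⟨r0, r1, r3, r5, r6⟩ := hreg
  obtain ⟨a0, a1, a2, a6, a7⟩ := harr
  have hx := hU (s.reg 9) (by omega)
  refine Runs.seq (Q := fun s' => Frame s₀ s' ∧ s'.reg 9 = s.reg 9 + 1 ∧
    s'.reg 10 = s₀.arr 6 (s.reg 9) ∧ ∀ a, s'.arr 3 a < s.reg 9 + 1) ?_ ?_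
  · refine Program.wp_runs ?_
    simp only [roundInit, Program.wp_seq, Program.wp_assign]
    simp [a6]
    refine ⟨by omega, by omega, ⟨?_, ?_⟩, fun a => ?_⟩
    · simp [r0, r1, r3, r5, r6]
    · simp [a0, a1, a2, a6, a7]
    · have := hseen a
      omega
  rintro s₁ ⟨hf₁, h9, h10, hseen₁⟩
  refine Runs.seq (search_runs hl ht hK hx (by omega) hW hf₁ h9 h10 hseen₁) ?_
  rintro s₂ ⟨hf₂, h9, h10, m, htree⟩
  refine Runs.seq (Q := Checking s₀ src c (s.reg 9 + 1) (s₀.arr 6 (s.reg 9)) (s₀.reg 5)) ?_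
    fun s₃ hs₃ => Runs.loop (I := Checking s₀ src c (s.reg 9 + 1) (s₀.arr 6 (s.reg 9)))
      (fun n s h hb => Program.wp_runs (h.step hc hN hU ⟨_, by omega, rfl⟩ (by omega) hb)) ?_ hs₃
  · refine Program.wp_runs ?_
    obtain ⟨hreg, harr⟩ := hf₂
    simp only [List.mem_cons, List.not_mem_nil, or_false, forall_eq_or_imp, forall_eq] at hreg harr
    simp only [Program.wp_assign, RExpr.eval_const, Nat.zero_le, true_and]
    refine Or.inl ⟨⟨?_, ?_⟩, ?_, ?_, ?_, ⟨m, ?_⟩, ?_⟩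
    · simp [hreg]
    · simp [harr]
    · simpa using h9
    · simpa using h10
    · simp
    · simpa using htree
    · simp
  · rintro k s' (⟨hf, h9, h10, hk, ⟨m, htree⟩, hnone⟩ | ⟨hF, -⟩) hb'
    · have h5 := hf.reg 5 (by simp)
      simp only [checkTest, Test.holds_lt, RExpr.eval_reg, not_lt] at hb'
      refine ⟨s₀.reg 5 - (s.reg 9 + 1), by omega, Or.inl ⟨hf, by rw [h9], ?_, ?_⟩⟩
      · rw [h9]
        exact htree.seen_le
      · rw [h9]
        intro i hi j hj hij
        rcases Nat.lt_succ_iff_lt_or_eq.1 hi with hi | rfl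
        · exact hno i hi j hj hij
        · intro hr
          exact hnone j (by omega) hij ((htree.seen_iff_reaches _).2 hr)
    · exact ⟨0, by omega, Or.inr ⟨hF, rfl⟩⟩

theorem rounds_runs {s₀ : State} {c M N : ℕ} (hc : c = 10 ∨ c = 17) (hN : s₀.reg 5 ≤ N)
    (hU : ∀ i < s₀.reg 5, s₀.arr 6 i ≤ M)
    (hl : Links (s₀.reg 6) src (s₀.arr 0) (s₀.arr 1))
    (ht : ∀ i, 1 ≤ i → i ≤ s₀.reg 6 → s₀.arr 2 i ≤ M) (hK : s₀.reg 6 ≤ N)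
    (hW : s₀.reg 3 + 8 * (M + N + 2) ≤ W) (hseen : ∀ a, s₀.arr 3 a = 0) :
    Runs W (rounds c) s₀ ((Program.assign 9 (.const 0)).cost +
        (s₀.reg 5 + 1) * (roundTest.cost + 1 + roundCost c (s₀.reg 6) (s₀.reg 5)))
      fun s => (s.reg 0 = s₀.reg 0 ∧ ∀ i < s₀.reg 5, ∀ j < s₀.reg 5,
        (c = 10 → s₀.arr 6 j = s₀.arr 6 i) →
        ¬ Relation.ReflTransGen (edgeRel s₀ src) (s₀.arr 6 i) (complCode (s₀.arr 6 j))) ∨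
        Found s₀ src c s := by
  refine Runs.seq (Q := Rounds s₀ src c (s₀.reg 5)) (Program.wp_runs ?_) fun s hs =>
    Runs.loop (I := Rounds s₀ src c) (fun n s h hb => h.step hc hN hU hl ht hK hW hb) ?_ hs
  · simp only [Program.wp_assign, RExpr.eval_const, Nat.zero_le, true_and]
    refine Or.inl ⟨⟨?_, ?_⟩, ?_, ?_, ?_⟩
    · simp
    · simp
    · simp
    · simp [hseen]
    · simp
  · rintro n s (⟨hf, -, -, hno⟩ | ⟨hF, -⟩) hb
    · have h5 := hf.reg 5 (by simp)
      simp only [roundTest, Test.holds_lt, RExpr.eval_reg, not_lt] at hb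
      exact Or.inl ⟨hf.reg 0 (by simp), fun i hi => hno i (by omega)⟩
    · exact Or.inr hF

end Rounds

/-! ### Writing out the clauses of a chain -/

/-- The unit-clause of the last literal of `l`, and the implications from each literal of `l` to the
preceding one. -/
def chainList : List Lit → List (List Lit)
  | [] => []
  | [y] => [[y]]
  | b :: a :: t => chainList (a :: t) ++ [[a.compl, b]]

theorem length_chainList (l : List Lit) : (chainList l).length = l.length := by
  induction l with
  | nil => rfl
  | cons b t ih =>
    cases t with
    | nil => rfl
    | cons a t => simpa [chainList] using ih

theorem length_clauseWords_chainList (b : Lit) (t : List Lit) :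
    (clauseWords (chainList (b :: t))).length = 2 + 3 * t.length := by
  induction t generalizing b with
  | nil => simp [chainList, clauseWords]
  | cons a t ih =>
    rw [chainList, clauseWords_append, List.length_append, ih]
    simp [clauseWords]
    omega

theorem toFinset_chainList {l : List Lit} {y : Lit} (hy : l.getLast? = some y) :
    ((chainList l).map List.toFinset).toFinset = {{y}} ∪ chainClauses l.reverse := by
  induction l with
  | nil => simp at hy
  | cons b t ih =>
    cases t with
    | nil =>
      obtain rfl : b = y := by simpa using hy
      simp [chainList, chainClauses]
    | cons a t =>
      have ih := ih (by simpa using hy)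
      have hrev : (b :: a :: t).reverse = t.reverse ++ [a, b] := by simp
      rw [chainList, List.map_append, List.toFinset_append, ih, hrev, chainClauses_append_pair,
        ← List.reverse_cons, Finset.union_assoc, Finset.insert_eq,
        Finset.union_comm (chainClauses _)]
      simp

/-- Only sources of implications occur complemented, and the first literal of `l`, being the end of
the chain, is not a source; hence the tail. -/
theorem mem_of_mem_chainList {l : List Lit} {C : List Lit} (hC : C ∈ chainList l) {z : Lit}
    (hz : z ∈ C) : z ∈ l ∨ z.compl ∈ l.tail := by
  induction l with
  | nil => simp [chainList] at hC
  | cons b t ih =>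
    cases t with
    | nil =>
      left
      simp only [chainList, List.mem_singleton] at hC
      rwa [hC] at hz
    | cons a t =>
      rw [chainList, List.mem_append, List.mem_singleton] at hC
      rcases hC with hC | rfl
      · rcases ih hC with h | h
        · exact Or.inl (List.mem_cons_of_mem _ h)
        · exact Or.inr (List.mem_cons_of_mem _ h)
      · simp only [List.mem_cons, List.not_mem_nil, or_false] at hz
        rcases hz with rfl | rfl
        · right; simp
        · left; simp

theorem nodup_of_mem_chainList {l : List Lit} (h : l.IsChain fun b a => a.1 ≠ b.1) {C : List Lit}
    (hC : C ∈ chainList l) : C.Nodup := by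
  induction l with
  | nil => simp [chainList] at hC
  | cons b t ih =>
    cases t with
    | nil =>
      simp only [chainList, List.mem_singleton] at hC
      simp [hC]
    | cons a t =>
      rw [chainList, List.mem_append, List.mem_singleton] at hC
      rcases hC with hC | rfl
      · exact ih h.tail hC
      · have := (List.isChain_cons_cons.1 h).1
        simp only [List.nodup_cons, List.mem_singleton, List.not_mem_nil, not_false_eq_true,
          List.nodup_nil, and_true]
        rintro rfl
        exact this rfl

/-- The clause added for `c` contains the complement of `a`, whose variable does not recur in `t`,
so no earlier clause contains that literal. Nothing is required of `c`, which in a lasso repeats a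
variable. -/
theorem nodup_chainList {c : Lit} {t : List Lit} (ht : DistinctVars t) :
    ((chainList (c :: t)).map List.toFinset).Nodup := by
  induction t generalizing c with
  | nil => simp [chainList]
  | cons a t ih =>
    have ha := List.nodup_cons.1 ht
    rw [chainList, List.map_append, List.nodup_append]
    refine ⟨ih ha.2, by simp, ?_⟩
    intro C hC D hD e
    obtain ⟨C', hC', rfl⟩ := List.mem_map.1 hC
    simp only [List.map_cons, List.map_nil, List.mem_singleton] at hD
    have hz : a.compl ∈ C' := by
      rw [← List.mem_toFinset, e, hD]
      simp
    have hvar : ∀ z ∈ t, z.1 ≠ a.1 := fun z hz e => ha.1 (e ▸ List.mem_map_of_mem hz)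
    rcases mem_of_mem_chainList hC' hz with h | h
    · rcases List.mem_cons.1 h with h | h
      · exact a.compl_ne h
      · exact hvar _ h rfl
    · rw [Lit.compl_compl] at h
      exact hvar _ h rfl

/-- `c :: t` is, in reverse order, a chain of implications from `y` to `c`, where only `c` may be the
complement of another literal of the chain. -/
structure RevChain (L : List (List Lit)) (y c : Lit) (t : List Lit) : Prop where
  last : (c :: t).getLast? = some y
  chain : (c :: t).IsChain fun b a => listImplies L a b
  distinct : DistinctVars t
  notMem : c ∉ t

/-! ### From reverse chains to minimally unsatisfiable subsets -/

theorem Implies.of_listImplies {L : List (List Lit)} {F : CNF} (hL : IsTwoList L)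
    (hF : Lists L F) {a b : Lit} (h : listImplies L a b) : Implies F a b := by
  have hmem : ∀ C ∈ L, C.toFinset ∈ F := fun C hC => by
    rw [← hF.2.2]
    simpa using ⟨C, hC, rfl⟩
  rcases h with h | h
  · refine ⟨?_, by simpa using hmem _ h⟩
    rcases hL _ h with ⟨p, hp⟩ | ⟨p, q, hpq, e⟩
    · simp at hp
    · simp only [List.cons.injEq, and_true] at e
      rw [← e.1, ← e.2] at hpq
      exact hpq
  · refine ⟨?_, by simpa [Finset.pair_comm] using hmem _ h⟩
    rcases hL _ h with ⟨p, hp⟩ | ⟨p, q, hpq, e⟩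
    · simp at hp
    · simp only [List.cons.injEq, and_true] at e
      rw [← e.1, ← e.2] at hpq
      exact hpq.symm

theorem distinctVars_cons {c : Lit} {t : List Lit} (ht : DistinctVars t) (h1 : c ∉ t)
    (h2 : c.compl ∉ t) : DistinctVars (c :: t) := by
  refine List.nodup_cons.2 ⟨fun h => ?_, ht⟩
  obtain ⟨z, hz, e⟩ := List.mem_map.1 h
  rcases Lit.eq_or_eq_compl e with rfl | rfl
  · exact h1 hz
  · exact h2 hz

/-- The walk has reached the root: `y → … → x̄` has distinct variables and gives Family I. Here `x`
is not on the chain but `y` is, whence `x ≠ y`. -/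
theorem RevChain.isMUS_of_unit {L : List (List Lit)} {F : CNF} (hL : IsTwoList L)
    (hF : Lists L F) (hcs : IsClauseSet F) {x y c : Lit} {t : List Lit} (h : RevChain L y c t)
    (hx : [x] ∈ L) (hy : [y] ∈ L) (hc : c = x.compl) (hct : c.compl ∉ t) :
    ∃ F', Lists (chainList (c :: t) ++ [[x]]) F' ∧ IsMUS F' F ∧ 1 ≤ unitCount F' ∧ x ≠ y := by
  have hmem : ∀ C ∈ L, C.toFinset ∈ F := fun C hC => by
    rw [← hF.2.2]
    simpa using ⟨C, hC, rfl⟩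
  have hchain : (c :: t).reverse.IsChain (Implies F) := by
    rw [List.isChain_reverse]
    exact h.chain.imp fun _ _ => Implies.of_listImplies hL hF
  have hsub : ({{y}, {x}} ∪ chainClauses (c :: t).reverse : CNF) ⊆ F := by
    refine Finset.union_subset ?_ (chainClauses_subset hchain)
    have h1 := hmem _ hy
    have h2 := hmem _ hx
    simp only [List.toFinset_cons, List.toFinset_nil, insert_empty_eq] at h1 h2
    simp only [Finset.insert_subset_iff, Finset.singleton_subset_iff]
    exact ⟨h1, h2⟩
  have hd : DistinctVars (c :: t).reverse := by
    rw [DistinctVars, List.map_reverse, List.nodup_reverse]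
    exact distinctVars_cons h.distinct h.notMem hct
  have hxt : x ∉ c :: t := by
    subst hc
    rw [Lit.compl_compl] at hct
    simpa [hct] using x.compl_ne.symm
  have hmu : IsMU ({{y}, {x}} ∪ chainClauses (c :: t).reverse) :=
    isMU_of_chain (fun C hC => hcs C (hsub hC)) hd
      (by rw [List.head?_reverse]; exact h.last) (by simp [hc]) rfl
  have hunit : 1 ≤ unitCount ({{y}, {x}} ∪ chainClauses (c :: t).reverse) :=
    one_le_unitCount (x := y) (by simp)
  have hxy : x ≠ y := by
    rintro rfl
    exact hxt (List.mem_of_getLast? h.last)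
  have hlists : Lists (chainList (c :: t) ++ [[x]])
      ({{y}, {x}} ∪ chainClauses (c :: t).reverse) := by
    refine ⟨?_, ?_, ?_⟩
    · intro C hC
      rcases List.mem_append.1 hC with hC | hC
      · exact nodup_of_mem_chainList
          (h.chain.imp fun _ _ h => (Implies.of_listImplies hL hF h).1) hC
      · rw [List.mem_singleton.1 hC]
        simp
    · rw [List.map_append, List.nodup_append]
      refine ⟨nodup_chainList h.distinct, by simp, ?_⟩
      intro C hC D hD e
      obtain ⟨C', hC', rfl⟩ := List.mem_map.1 hC
      simp only [List.map_cons, List.map_nil, List.mem_singleton] at hD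
      have hz : x ∈ C' := by
        rw [← List.mem_toFinset, e, hD]
        simp
      rcases mem_of_mem_chainList hC' hz with h' | h'
      · exact hxt h'
      · exact h.notMem (by rw [hc]; exact h')
    · rw [List.map_append, List.toFinset_append, toFinset_chainList h.last]
      rw [Finset.insert_eq, Finset.union_right_comm]
      rfl
  exact ⟨_, hlists, ⟨hsub, hmu⟩, hunit, hxy⟩

/-- The walk has met a complementary pair: the chain from `y` returns to the complement of one of
its literals, and the unit-clause of the root is not needed. -/
theorem RevChain.isMUS_of_mem {L : List (List Lit)} {F : CNF} (hL : IsTwoList L)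
    (hF : Lists L F) (hcs : IsClauseSet F) {y c : Lit} {t : List Lit} (h : RevChain L y c t)
    (hy : [y] ∈ L) (hct : c.compl ∈ t) :
    ∃ F', Lists (chainList (c :: t)) F' ∧ IsMUS F' F ∧ unitCount F' = 1 := by
  have hmem : ∀ C ∈ L, C.toFinset ∈ F := fun C hC => by
    rw [← hF.2.2]
    simpa using ⟨C, hC, rfl⟩
  have hchain : (c :: t).reverse.IsChain (Implies F) := by
    rw [List.isChain_reverse]
    exact h.chain.imp fun _ _ => Implies.of_listImplies hL hF
  have hsub : ({{y}} ∪ chainClauses (c :: t).reverse : CNF) ⊆ F := by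
    refine Finset.union_subset ?_ (chainClauses_subset hchain)
    simpa using hmem _ hy
  have hd : DistinctVars t.reverse := by
    rw [DistinctVars, List.map_reverse, List.nodup_reverse]
    exact h.distinct
  have heq : ({{y}} ∪ chainClauses (c :: t).reverse : CNF) =
      {{y}} ∪ chainClauses (t.reverse ++ [c.compl.compl]) := by simp
  refine ⟨{{y}} ∪ chainClauses (c :: t).reverse, ⟨?_, nodup_chainList h.distinct,
    toFinset_chainList h.last⟩, ⟨hsub, ?_⟩, ?_⟩
  · intro C hC
    exact nodup_of_mem_chainList
      (h.chain.imp fun _ _ h => (Implies.of_listImplies hL hF h).1) hC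
  · refine isMU_of_lasso (fun C hC => hcs C (hsub hC)) hd ?_ (by simpa using hct) heq
    rw [List.head?_reverse, ← h.last]
    cases t with
    | nil => simp at hct
    | cons a t => simp
  · refine unitCount_eq_one_of_lasso hd ?_ heq
    rw [List.getLast?_reverse]
    cases t with
    | nil => simp at hct
    | cons a t =>
      have := (Implies.of_listImplies hL hF (List.isChain_cons_cons.1 h.chain).1).1
      simpa using this

/-- Marks the complement of the root of the search by `1`, starts at the complement of the unit
literal in register `17`, and writes its unit-clause. -/
def walkInit : Program :=
  .storeAt 7 (.compl (.reg 10)) (.const 1) ;;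
  .assign 18 (.compl (.reg 17)) ;;
  .storeAt 7 (.reg 18) (.const 2) ;;
  .store (.const 1) (.const 1) ;;
  .store (.const 2) (.reg 17) ;;
  .assign 19 (.const 3) ;;
  .assign 20 (.const 1)

/-- Goes to the parent in the search tree, writes the clause of the edge, and marks the parent
by `2`. -/
def walkBody : Program :=
  .assign 21 (.get 4 (.reg 18)) ;;
  .store (.reg 19) (.const 2) ;;
  .store (.add (.reg 19) (.const 1)) (.reg 18) ;;
  .store (.add (.reg 19) (.const 2)) (.compl (.reg 21)) ;;
  .assign 19 (.add (.reg 19) (.const 3)) ;;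
  .assign 20 (.add (.reg 20) (.const 1)) ;;
  .storeAt 7 (.reg 21) (.const 2) ;;
  .assign 18 (.reg 21)

def walkTest : Test := .eq (.get 7 (.compl (.reg 18))) (.const 0)

/-- Writes the unit-clause of the root, if this has been reached without meeting complementary
literals, and the number of clauses. -/
def walkEnd : Program :=
  .branch (.eq (.get 7 (.compl (.reg 18))) (.const 1))
    (.store (.reg 19) (.const 1) ;;
     .store (.add (.reg 19) (.const 1)) (.reg 10) ;;
     .assign 20 (.add (.reg 20) (.const 1)))
    .skip ;;
  .store (.const 0) (.reg 20)

def walk : Program := walkInit ;; .loop walkTest walkBody ;; walkEnd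

/-- The words `ws` are in the memory from the address `1` on. -/
def Written (s : State) (ws : List ℕ) : Prop := ∀ k < ws.length, s.mem (1 + k) = ws.getD k 0

theorem Written.append {s s' : State} {ws us : List ℕ} (h : Written s ws)
    (hold : ∀ a, 1 ≤ a → a < 1 + ws.length → s'.mem a = s.mem a)
    (hnew : ∀ k < us.length, s'.mem (1 + ws.length + k) = us.getD k 0) :
    Written s' (ws ++ us) := by
  intro k hk
  rw [List.length_append] at hk
  rcases Nat.lt_or_ge k ws.length with h' | h'
  · rw [List.getD_append _ _ _ _ h', hold _ (by omega) (by omega), h k h']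
  · rw [List.getD_append_right _ _ _ _ h', ← hnew _ (by omega)]
    congr 1
    omega

/-- The invariant of the loop of `walk`, where `n` literals have been found in the search, with the
parents `par` and in the order `queue`, the walk is at the literal number `i`, the complement of
`c`, and the clauses of the chain `c :: t` have been written. -/
structure Walking (L : List (List Lit)) (x y : Lit) (B : ℕ) (par queue : ℕ → ℕ) (n i : ℕ) (c : Lit)
    (t : List Lit) (s : State) : Prop where
  chain : RevChain L y c t
  lt : i < n
  queue_eq : queue i = c.compl.code
  index : ∀ q ∈ t, ∃ j, i < j ∧ j < n ∧ queue j = q.compl.code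
  len : t.length + 1 + i ≤ n
  answer : s.reg 0 = 1
  output : s.reg 1 = 0
  base : s.reg 3 = B
  root : s.reg 10 = x.code
  cur : s.reg 18 = c.compl.code
  out : s.reg 19 = 3 + 3 * t.length
  count : s.reg 20 = t.length + 1
  parent : s.arr 4 = par
  mark : ∀ q : Lit, s.arr 7 q.code = if q.compl ∈ c :: t then 2 else if q = x.compl then 1 else 0
  written : Written s (clauseWords (chainList (c :: t)))

/-! ### Correctness of the walk -/

theorem clauseWords_chainList_cons (b a : Lit) (t : List Lit) :
    clauseWords (chainList (b :: a :: t)) =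
      clauseWords (chainList (a :: t)) ++ [2, a.compl.code, b.code] := by
  rw [chainList, clauseWords_append]
  simp [clauseWords]

theorem code_le_of_listImplies {L : List (List Lit)} {M : ℕ}
    (hM : ∀ C ∈ L, ∀ p ∈ C, p.code ≤ M) {a b : Lit} (h : listImplies L a b) :
    a.compl.code ≤ M ∧ b.code ≤ M := by
  rcases h with h | h
  · exact ⟨hM _ h _ (by simp), hM _ h _ (by simp)⟩
  · exact ⟨hM _ h _ (by simp), hM _ h _ (by simp)⟩

/-- The tree edge from the parent `p` to the complement of `c`, read contrapositively, extends the
chain by an implication from `c` to the complement of `p`. Parents come earlier in the queue, which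
gives termination. -/
theorem Walking.step {L : List (List Lit)} {x y : Lit} {m M K n i r : ℕ} {src tgt : ℕ → ℕ}
    {seen par queue : ℕ → ℕ} {c : Lit} {t : List Lit} {s : State}
    (hM : ∀ C ∈ L, ∀ p ∈ C, p.code ≤ M) (hW : 32 * (m + M + 2) ≤ W)
    (hK : K ≤ 2 * m)
    (htree : SearchTree K src tgt r x.code seen par queue n)
    (hedge : ∀ a b, (∃ i, 1 ≤ i ∧ i ≤ K ∧ src i = a ∧ tgt i = b) →
      ∃ p q : Lit, listImplies L p q ∧ a = p.code ∧ b = q.code)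
    (h : Walking L x y (8 * (2 * m + 1)) par queue n i c t s) (hb : walkTest.Holds s) :
    walkBody.wp W
      (fun s' => ∃ i' < i, ∃ c' t', Walking L x y (8 * (2 * m + 1)) par queue n i' c' t' s') s := by
  have hcur := h.cur
  have hout := h.out
  have hcount := h.count
  have hbase := h.base
  have hlen := h.len
  have hn := htree.le
  simp only [walkTest, Test.holds_eq, RExpr.eval_get, RExpr.eval_compl, RExpr.eval_reg,
    RExpr.eval_const, hcur, complCode_code, Lit.compl_compl, h.mark] at hb
  have hct : c.compl ∉ c :: t := by
    intro h
    simp [h] at hb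
  have hcx : c ≠ x.compl := by
    intro h
    simp only [hct, if_false] at hb
    simp [h] at hb
  -- At position `0` the walk is at the root, so `c` is the complement of `x` and its mark is
  -- nonzero.
  have hi : 0 < i := by
    rcases Nat.eq_zero_or_pos i with rfl | h0
    · refine absurd ?_ hcx
      have := htree.start.symm.trans h.queue_eq
      rw [Lit.code_inj] at this
      rw [this, Lit.compl_compl]
    · exact h0
  obtain ⟨j, hji, hpar, hk⟩ := htree.parent i hi h.lt
  obtain ⟨p, q, hpq, hp, hq⟩ := hedge _ _ hk
  rw [h.queue_eq] at hq hpar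
  rw [Lit.code_inj] at hq
  subst hq
  have hle := code_le_of_listImplies hM hpq
  have hcle := complCode_le p.compl.code
  rw [complCode_code, Lit.compl_compl] at hcle
  have hxle : s.arr 4 c.compl.code = p.code := by rw [h.parent, hpar, hp]
  have hchain : RevChain L y p.compl (c :: t) := by
    refine ⟨by simpa using h.chain.last, List.isChain_cons_cons.2 ⟨?_, h.chain.chain⟩,
      distinctVars_cons h.chain.distinct h.chain.notMem fun h => hct (List.mem_cons_of_mem _ h), ?_⟩
    · exact hpq.symm
    -- All literals visited so far have later queue positions than the parent, and the queue has no
    -- repetitions.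
    · intro hmem
      have : ∃ j', j < j' ∧ j' < n ∧ queue j' = p.code := by
        rcases List.mem_cons.1 hmem with e | hmem
        · exact ⟨i, hji, h.lt, by rw [h.queue_eq, ← e, Lit.compl_compl]⟩
        · obtain ⟨j', h1, h2, h3⟩ := h.index _ hmem
          exact ⟨j', by omega, h2, by rw [h3, Lit.compl_compl]⟩
      obtain ⟨j', h1, h2, h3⟩ := this
      have := htree.inj j j' (by omega) h2 (by rw [h3, hp])
      omega
  generalize hQ : (fun s' => ∃ i' < i, ∃ c' t',
    Walking L x y (8 * (2 * m + 1)) par queue n i' c' t' s') = Q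
  simp [walkBody, hcur, hxle]
  and_intros <;> try omega
  rw [← hQ]
  have l0 : s.reg 19 < s.reg 3 := by omega
  have l1 : s.reg 19 + 1 < s.reg 3 := by omega
  have l2 : s.reg 19 + 2 < s.reg 3 := by omega
  refine ⟨j, hji, p.compl, c :: t, hchain, by omega, by rw [hp, Lit.compl_compl], ?_, ?_, ?_, ?_, ?_,
    ?_, ?_, ?_, ?_, ?_, ?_, ?_⟩
  · intro q hq
    rcases List.mem_cons.1 hq with rfl | hq
    · exact ⟨i, hji, h.lt, h.queue_eq⟩
    · obtain ⟨j', h1, h2, h3⟩ := h.index _ hq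
      exact ⟨j', by omega, h2, h3⟩
  · simp only [List.length_cons]
    omega
  · simpa using h.answer
  · simpa using h.output
  · simpa using h.base
  · simpa using h.root
  · simp
  · simp
    omega
  · simp [h.count]
  · simpa [State.arr_setMem, l0, l1, l2] using h.parent
  · intro q
    simp [State.arr_setMem, l0, l1, l2, Function.update_apply, h.mark, Lit.compl_injective.eq_iff]
    split_ifs <;> simp_all
  · rw [clauseWords_chainList_cons]
    have hlen' := length_clauseWords_chainList c t
    refine h.written.append ?_ ?_
    · intro a ha1 ha2
      have la : a < s.reg 3 := by omega
      simp [State.mem_setArr, la, State.mem_setMem]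
      grind
    · intro k hk
      rw [hlen']
      have e : 1 + (2 + 3 * t.length) + k = s.reg 19 + k := by omega
      rw [e]
      simp only [List.length_cons, List.length_nil] at hk
      interval_cases k <;> simp [State.mem_setArr, State.mem_setMem, l0, l1, l2]

/-- The mark `2` is stored after the mark `1` and prevails if `x = y`. If `y` is the complement of
`x`, the mark `1` stops the walk at once. -/
theorem Walking.init {L : List (List Lit)} {x y : Lit} {m M n i : ℕ}
    {s : State} (hW : 32 * (m + M + 2) ≤ W)
    (hx : x.code ≤ M) (hy : y.code ≤ M)
    (hi : i < n) (hyi : s.arr 5 i = y.compl.code)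
    (answer : s.reg 0 = 1) (output : s.reg 1 = 0) (base : s.reg 3 = 8 * (2 * m + 1))
    (root : s.reg 10 = x.code) (unit : s.reg 17 = y.code) (mark : ∀ a, s.arr 7 a = 0) :
    walkInit.wp W (Walking L x y (8 * (2 * m + 1)) (s.arr 4) (s.arr 5) n i y []) s := by
  have hxc := complCode_le x.code
  have hyc := complCode_le y.code
  rw [complCode_code] at hxc hyc
  generalize hQ : Walking L x y (8 * (2 * m + 1)) (s.arr 4) (s.arr 5) n i y [] = Q
  simp [walkInit, root, unit]
  and_intros <;> try omega
  rw [← hQ]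
  have l1 : 1 < s.reg 3 := by omega
  have l2 : 2 < s.reg 3 := by omega
  refine ⟨⟨by simp, by simp, by simp [DistinctVars], by simp⟩, hi, hyi, by simp, ?_, ?_, ?_, ?_, ?_,
    ?_, ?_, ?_, ?_, ?_, ?_⟩
  · simp
    omega
  · simpa using answer
  · simpa using output
  · simpa using base
  · simpa using root
  · simp
  · simp
  · simp
  · simp [State.arr_setMem, l1, l2]
  · intro q
    have : q.compl = y ↔ q = y.compl := by
      constructor
      · rintro rfl; simp
      · rintro rfl; simp
    simp [State.arr_setMem, l1, l2, Function.update_apply, mark, this]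
  · intro k hk
    rw [length_clauseWords_chainList] at hk
    simp only [List.length_nil] at hk
    interval_cases k <;> simp [State.mem_setMem, chainList, clauseWords]

theorem Walking.finish {L : List (List Lit)} {F : CNF} {x y : Lit} {m M n i K r : ℕ}
    {src tgt : ℕ → ℕ} {seen par queue : ℕ → ℕ} {c : Lit} {t : List Lit} {s : State}
    (hL : IsTwoList L) (hF : Lists L F) (hcs : IsClauseSet F)
    (hM : ∀ C ∈ L, ∀ p ∈ C, p.code ≤ M) (hW : 32 * (m + M + 2) ≤ W) (hK : K ≤ 2 * m)
    (hx : [x] ∈ L) (hy : [y] ∈ L)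
    (htree : SearchTree K src tgt r x.code seen par queue n)
    (h : Walking L x y (8 * (2 * m + 1)) par queue n i c t s) (hb : ¬ walkTest.Holds s) :
    walkEnd.wp W (fun s' => s'.reg 0 = 1 ∧ ∃ F' L', IsMUS F' F ∧ 1 ≤ unitCount F' ∧
      (x = y → unitCount F' = 1) ∧ Lists L' F' ∧ Holds s' (s'.reg 1) L') s := by
  have hcur := h.cur
  have hout := h.out
  have hcount := h.count
  have hbase := h.base
  have hlen := h.len
  have hn := htree.le
  have hxM := hM _ hx x (by simp)
  have hlen' := length_clauseWords_chainList c t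
  have hc0 : c.compl ≠ c := c.compl_ne
  have hmark : s.arr 7 c.code = if c.compl ∈ t then 2 else if c = x.compl then 1 else 0 := by
    simp [h.mark, hc0]
  simp only [walkTest, Test.holds_eq, RExpr.eval_get, RExpr.eval_compl, RExpr.eval_reg,
    RExpr.eval_const, hcur, complCode_code, Lit.compl_compl, hmark] at hb
  have holds : ∀ (s' : State) (L' : List (List Lit)), s'.mem 0 = L'.length →
      Written s' (clauseWords L') → Holds s' 0 L' := by
    intro s' L' h0 hw k hk
    cases k with
    | zero => simpa [encode] using h0
    | succ k =>
      have := hw k (by simpa [encode, clauseWords] using hk)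
      rw [Nat.zero_add, Nat.add_comm k 1, this]
      simp [encode, clauseWords, Nat.add_comm 1 k]
  generalize hQ : (fun s' : State => s'.reg 0 = 1 ∧ ∃ F' L', IsMUS F' F ∧ 1 ≤ unitCount F' ∧
      (x = y → unitCount F' = 1) ∧ Lists L' F' ∧ Holds s' (s'.reg 1) L') = Q
  -- Mark `2` means a lasso; otherwise the mark is `1` and the root has been reached.
  by_cases hct : c.compl ∈ t
  · obtain ⟨F', h1, h2, h3⟩ := h.chain.isMUS_of_mem hL hF hcs hy hct
    simp [walkEnd, hcur, hmark, hct]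
    refine ⟨by omega, ?_⟩
    rw [← hQ]
    refine ⟨by simpa using h.answer, F', _, h2, h3.ge, fun _ => h3, h1, ?_⟩
    rw [State.reg_setMem, h.output]
    refine holds _ _ ?_ ?_
    · simp [State.mem_setMem, hcount, length_chainList]
    · intro k hk
      rw [State.mem_setMem, if_neg (by omega), h.written k hk]
  · have hcx : c = x.compl := by
      by_contra hcx
      simp [hct, hcx] at hb
    obtain ⟨F', h1, h2, h3, h4⟩ := h.chain.isMUS_of_unit hL hF hcs hx hy hcx hct
    rw [if_neg hct, if_pos hcx] at hmark
    simp [walkEnd, hcur, hmark, h.root]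
    and_intros <;> try omega
    rw [← hQ]
    refine ⟨by simpa using h.answer, F', _, h2, h3, fun e => absurd e h4, h1, ?_⟩
    have h10 : (((((s.setMem (s.reg 19) 1).setMem (s.reg 19 + 1) x.code).setReg 20
      (s.reg 20 + 1)).setMem 0 (s.reg 20 + 1)).reg 1) = 0 := by simpa using h.output
    rw [h10]
    refine holds _ _ ?_ ?_
    · simp [State.mem_setMem, hcount, length_chainList]
    · rw [clauseWords_append]
      refine h.written.append ?_ ?_
      · intro a ha1 ha2
        simp [State.mem_setMem]
        grind
      · intro k hk
        have e : 1 + (clauseWords (chainList (c :: t))).length + k = s.reg 19 + k := by omega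
        rw [e]
        simp only [clauseWords, List.flatMap_cons, List.flatMap_nil, List.append_nil,
          List.length_cons, List.map_cons, List.map_nil, List.length_nil] at hk ⊢
        (interval_cases k <;> simp [State.mem_setMem]); omega

theorem walk_runs {L : List (List Lit)} {F : CNF} {m M c : ℕ} {src : ℕ → ℕ} {s₀ s : State}
    (hm : m = L.length) (hL : IsTwoList L) (hF : Lists L F) (hcs : IsClauseSet F)
    (hM : ∀ C ∈ L, ∀ p ∈ C, p.code ≤ M) (hW : 32 * (m + M + 2) ≤ W)
    (hload : Loaded m L src s₀) (h : Found s₀ src c s) :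
    Runs W walk s (walkInit.cost + ((s₀.reg 6 + 1 + 1) * (walkTest.cost + 1 + walkBody.cost) +
        walkEnd.cost))
      fun s' => s'.reg 0 = 1 ∧ ∃ F' L', IsMUS F' F ∧ 1 ≤ unitCount F' ∧
        (c = 10 → unitCount F' = 1) ∧ Lists L' F' ∧ Holds s' (s'.reg 1) L' := by
  obtain ⟨x, hx, hx'⟩ := (hload.unit_iff _).1 h.unit_x
  obtain ⟨y, hy, hy'⟩ := (hload.unit_iff _).1 h.unit_y
  obtain ⟨r, n, htree, hr⟩ := h.tree
  rw [hx'] at htree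
  rw [hy', complCode_code] at hr
  obtain ⟨i, hi, hqi⟩ := (htree.seen_iff _).1 hr
  have hn := htree.le
  have hK : s₀.reg 6 ≤ 2 * m := by
    have := hload.edges
    omega
  refine Runs.seq (Program.wp_runs (Walking.init (L := L) hW (hM _ hx x (by simp))
    (hM _ hy y (by simp)) hi hqi h.answer (h.output.trans hload.output)
    (h.base.trans hload.base) hx' hy' fun a => by rw [h.mark, hload.mark])) fun s₁ hs₁ => ?_
  refine Runs.seq (Q := fun s' => ∃ i c t, Walking L x y (8 * (2 * m + 1)) (s.arr 4) (s.arr 5) n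
      i c t s' ∧ ¬ walkTest.Holds s')
    ((Runs.loop (I := fun i s' => ∃ c t, Walking L x y (8 * (2 * m + 1)) (s.arr 4) (s.arr 5) n
      -- The start has a queue position below `n`, and `n` is at most the number of edges plus one.
      i c t s') ?_ ?_ ⟨y, [], hs₁⟩).mono (Nat.mul_le_mul_right _ (by omega)) fun _ h => h) ?_
  · rintro i s' ⟨c, t, h⟩ hb
    exact Program.wp_runs
      (h.step hM hW hK htree (fun a b hab => (hload.edge_iff a b).1 hab) hb)
  · rintro i s' ⟨c, t, h⟩ hb
    exact ⟨i, c, t, h, hb⟩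
  · rintro s' ⟨i, c', t, h', hb⟩
    refine (Program.wp_runs (h'.finish hL hF hcs hM hW hK hx hy htree hb)).mono le_rfl ?_
    rintro s'' ⟨h0, F', L', h1, h2, h3, h4⟩
    refine ⟨h0, F', L', h1, h2, fun hc => h3 ?_, h4⟩
    have := h.same hc
    rw [hx', hy', Lit.code_inj] at this
    exact this.symm

/-! ### The algorithm -/

theorem Lists.isTwoList {L : List (List Lit)} {F : CNF} (h : Lists L F) (hF : IsTwoCNF F) :
    IsTwoList L := by
  intro C hC
  have hmem : C.toFinset ∈ F := by
    rw [← h.2.2]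
    simpa using ⟨C, hC, rfl⟩
  have hcard : C.toFinset.card = C.length := List.toFinset_card_of_nodup (h.1 C hC)
  have h2 := hF.2.1 _ hmem
  match C, h.1 C hC with
  | [], _ => exact absurd (by simpa using hmem) hF.2.2
  | [p], _ => exact Or.inl ⟨p, rfl⟩
  | [p, q], hnd =>
    refine Or.inr ⟨p, q, fun e => ?_, rfl⟩
    rcases Lit.eq_or_eq_compl e with rfl | rfl
    · simp at hnd
    · exact hF.1 _ hmem q (by simp) (by simp)
  | p :: q :: z :: t, _ =>
    rw [hcard] at h2
    simp at h2

theorem Lists.exists_mem {L : List (List Lit)} {F : CNF} (h : Lists L F) {C : Clause}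
    (hC : C ∈ F) : ∃ D ∈ L, D.toFinset = C := by
  rw [← h.2.2] at hC
  simpa using hC

theorem Lists.unit_mem {L : List (List Lit)} {F : CNF} (h : Lists L F) {x : Lit}
    (hx : ({x} : Clause) ∈ F) : [x] ∈ L := by
  obtain ⟨D, hD, e⟩ := h.exists_mem hx
  have hlen := List.toFinset_card_of_nodup (h.1 D hD)
  rw [e, Finset.card_singleton] at hlen
  obtain ⟨y, rfl⟩ := List.length_eq_one_iff.1 hlen.symm
  have : y = x := by simpa using e
  rwa [← this]

theorem Lists.listImplies {L : List (List Lit)} {F : CNF} (h : Lists L F) {a b : Lit}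
    (hab : Implies F a b) : listImplies L a b := by
  obtain ⟨D, hD, e⟩ := h.exists_mem hab.2
  have hlen := List.toFinset_card_of_nodup (h.1 D hD)
  have hne : a.compl ≠ b := fun e => hab.1 (by rw [← e]; rfl)
  rw [e, Finset.card_pair hne] at hlen
  obtain ⟨p, q, rfl⟩ := List.length_eq_two.1 hlen.symm
  have h1 : a.compl = p ∨ a.compl = q := by
    have : a.compl ∈ [p, q].toFinset := by rw [e]; simp
    simpa using this
  have h2 : b = p ∨ b = q := by
    have : b ∈ [p, q].toFinset := by rw [e]; simp
    simpa using this
  rcases h1 with h1 | h1 <;> rcases h2 with h2 | h2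
  · exact absurd (h1.trans h2.symm) hne
  · exact Or.inl (by rw [h1, h2]; exact hD)
  · exact Or.inr (by rw [h1, h2]; exact hD)
  · exact absurd (h1.trans h2.symm) hne

theorem Lists.sum_length {L : List (List Lit)} {F : CNF} (h : Lists L F) :
    (L.map List.length).sum = size F := by
  rw [size, ← h.2.2, List.sum_toFinset _ h.2.1, List.map_map]
  congr 1
  refine List.map_congr_left fun C hC => ?_
  exact (List.toFinset_card_of_nodup (h.1 C hC)).symm

theorem Lists.countP_unit {L : List (List Lit)} {F : CNF} (h : Lists L F) :
    (L.countP fun C => C.length = 1) = unitCount F := by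
  have hfilter : F.filter (fun C => C.card = 1) =
      ((L.map List.toFinset).filter fun C => C.card = 1).toFinset := by
    ext C
    rw [← h.2.2]
    simp
  rw [unitCount, hfilter, List.toFinset_card_of_nodup (h.2.1.filter _),
    ← List.countP_eq_length_filter, List.countP_map]
  refine List.countP_congr fun C hC => ?_
  simp [List.toFinset_card_of_nodup (h.1 C hC)]

theorem le_foldr_max {l : List ℕ} {a : ℕ} (h : a ∈ l) : a ≤ l.foldr max 0 := by
  induction l with
  | nil => simp at h
  | cons b t ih =>
    rw [List.foldr_cons]
    rcases List.mem_cons.1 h with rfl | h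
    · exact le_max_left _ _
    · exact (ih h).trans (le_max_right _ _)

theorem length_le_length_clauseWords (L : List (List Lit)) :
    L.length ≤ (clauseWords L).length := by
  induction L with
  | nil => simp
  | cons C L ih =>
    simp only [clauseWords, List.flatMap_cons, List.length_append, List.length_cons,
      List.length_map] at *
    omega

/-- With `N = wordParam L ≥ 2`, the left-hand side is at most `64 * N ≤ 2 ^ 7 * N ≤ N ^ 8`. -/
theorem le_wordParam_pow (L : List (List Lit)) :
    32 * (L.length + (encode L).foldr max 0 + 2) ≤ wordParam L ^ 8 := by
  have h1 : L.length + (encode L).foldr max 0 + 2 ≤ 2 * wordParam L := by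
    have := length_le_length_clauseWords L
    simp only [clauseWords] at this
    simp only [wordParam, encode, List.length_cons]
    omega
  have h2 : 2 ≤ wordParam L := by
    simp only [wordParam, encode, List.length_cons]
    omega
  calc 32 * (L.length + (encode L).foldr max 0 + 2)
      ≤ 2 ^ 7 * wordParam L := by omega
    _ ≤ wordParam L ^ 7 * wordParam L := Nat.mul_le_mul_right _ (Nat.pow_le_pow_left h2 7)
    _ = wordParam L ^ 8 := (pow_succ ..).symm

/-- Finds a minimally unsatisfiable subset with at least one unit-clause (for `c = 17`), or with
exactly one unit-clause (for `c = 10`). -/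
def findMUS (c : ℕ) : Program :=
  scan ;; rounds c ;; .branch (.eq (.reg 0) (.const 1)) walk .skip

def algorithmCost (c m K u : ℕ) : ℕ :=
  scanInit.cost + (m + 1) * ((Test.lt (.const 0) (.reg 2)).cost + 1 + scanBody.cost) +
    ((Program.assign 9 (.const 0)).cost +
        (u + 1) * (roundTest.cost + 1 + roundCost c K u) +
      ((Test.eq (.reg 0) (.const 1)).cost + 1 +
        (walkInit.cost + ((K + 1 + 1) * (walkTest.cost + 1 + walkBody.cost) + walkEnd.cost))))

/-- For fixed `c` the program parts have constant costs. The remaining terms are at most of the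
orders `u * K` and `u * u`, both bounded through `K ≤ l` and `u ≤ l`. -/
theorem algorithmCost_le (c : ℕ) : ∃ A, ∀ m K u l, m ≤ l → K ≤ l → u ≤ l →
    algorithmCost c m K u ≤ A * ((u + 1) * (l + 1)) := by
  simp only [algorithmCost, roundCost, searchCost]
  generalize scanInit.cost = a₁
  generalize (Test.lt (.const 0) (.reg 2)).cost + 1 + scanBody.cost = a₂
  generalize (Program.assign 9 (.const 0)).cost = a₃
  generalize roundTest.cost + 1 = a₄
  generalize roundInit.cost = a₅
  generalize searchInit.cost = a₆
  generalize searchTest.cost + 1 + searchBody.cost = a₇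
  generalize (Program.assign 16 (.const 0)).cost = a₈
  generalize checkTest.cost + 1 + (checkBody c).cost = a₉
  generalize (Test.eq (.reg 0) (.const 1)).cost + 1 = b₁
  generalize walkInit.cost = b₂
  generalize walkTest.cost + 1 + walkBody.cost = b₃
  generalize walkEnd.cost = b₄
  refine ⟨a₁ + a₂ + a₃ + a₄ + a₅ + a₆ + 2 * a₇ + a₈ + a₉ + b₁ + b₂ + 2 * b₃ + b₄,
    fun m K u l hm hK hu => ?_⟩
  have h1 : m + 1 ≤ l + 1 := by omega
  have h2 : 2 * K + 1 + 1 ≤ 2 * (l + 1) := by omega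
  have h3 : u + 1 ≤ l + 1 := by omega
  have h4 : K + 1 + 1 ≤ 2 * (l + 1) := by omega
  generalize hz : l + 1 = z at *
  have hz1 : 1 ≤ z := by omega
  have hv : 1 ≤ u + 1 := by omega
  generalize u + 1 = v at *
  calc a₁ + (m + 1) * a₂ + (a₃ + v * (a₄ + (a₅ + (a₆ + (2 * K + 1 + 1) * a₇ + (a₈ + v * a₉)))) +
        (b₁ + (b₂ + ((K + 1 + 1) * b₃ + b₄))))
      ≤ a₁ * (v * z) + (v * z) * a₂ + (a₃ * (v * z) + v * (a₄ * z + (a₅ * z + (a₆ * z +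
        (2 * z) * a₇ + (a₈ * z + z * a₉)))) +
        (b₁ * (v * z) + (b₂ * (v * z) + ((2 * (v * z)) * b₃ + b₄ * (v * z))))) := by
        have hvz : 1 ≤ v * z := Nat.mul_le_mul hv hz1
        have hzv : z ≤ v * z := Nat.le_mul_of_pos_left z hv
        gcongr
        all_goals first
          | exact Nat.le_mul_of_pos_right _ hvz
          | exact Nat.le_mul_of_pos_right _ hz1
          | omega
    _ = _ := by ring

theorem findMUS_runs {L : List (List Lit)} {F : CNF} (hF : IsTwoCNF F) (hL : Lists L F) {c : ℕ}
    (hc : c = 10 ∨ c = 17) :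
    Runs (wordParam L ^ 8) (findMUS c) (initState L)
      (algorithmCost c L.length (size F - unitCount F) (unitCount F)) fun s =>
      (s.reg 0 = 0 ∧ ∀ x y : Lit, ({x} : Clause) ∈ F → ({y} : Clause) ∈ F → (c = 10 → x = y) →
        ¬ Reaches F x y.compl) ∨
      (s.reg 0 = 1 ∧ ∃ F' L', IsMUS F' F ∧ 1 ≤ unitCount F' ∧
        (c = 10 → unitCount F' = 1) ∧ Lists L' F' ∧ Holds s (s.reg 1) L') := by
  have hTL := hL.isTwoList hF
  have hM : ∀ C ∈ L, ∀ p ∈ C, p.code ≤ (encode L).foldr max 0 := by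
    intro C hC p hp
    refine le_foldr_max (List.mem_cons_of_mem _ (List.mem_flatMap.2 ⟨C, hC, ?_⟩))
    exact List.mem_cons_of_mem _ (List.mem_map_of_mem hp)
  have hW := le_wordParam_pow L
  refine Runs.seq (scan_runs rfl hTL hM hW) ?_
  rintro s₀ ⟨src, hload⟩
  have hu : s₀.reg 5 = unitCount F := hload.units.trans hL.countP_unit
  have hK : s₀.reg 6 = size F - unitCount F := by
    have := hload.total
    rw [hL.sum_length] at this
    omega
  have hedges := hload.edges
  rw [← hK, ← hu]
  -- Edges plus twice the units make `2 * L.length`, so this bounds both numbers.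
  refine Runs.seq (rounds_runs (N := 2 * L.length) (M := (encode L).foldr max 0) hc (by omega) ?_
    hload.links ?_ (by omega) ?_ hload.seen) ?_
  · intro i hi
    obtain ⟨p, hp, e⟩ := (hload.unit_iff _).1 ⟨i, hi, rfl⟩
    rw [e]
    exact hM _ hp p (by simp)
  · intro i h1 h2
    obtain ⟨p, q, hpq, -, e⟩ := (hload.edge_iff _ _).1 ⟨i, h1, h2, rfl, rfl⟩
    rw [e]
    exact (code_le_of_listImplies hM hpq).2
  · rw [hload.base]
    omega
  rintro s (⟨h0, hno⟩ | hfound)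
  · have hb : ¬ (Test.eq (.reg 0) (.const 1)).Holds s := by simp [h0, hload.answer]
    refine ⟨_, s, .branch_neg hb (.skip s), ?_, Or.inl ⟨h0.trans hload.answer, ?_⟩⟩
    · have : 1 ≤ walkInit.cost := by simp [walkInit, Program.cost]; omega
      omega
    · intro x y hx hy hxy hr
      obtain ⟨i, hi, ei⟩ := (hload.unit_iff _).2 ⟨x, hL.unit_mem hx, rfl⟩
      obtain ⟨j, hj, ej⟩ := (hload.unit_iff _).2 ⟨y, hL.unit_mem hy, rfl⟩
      refine hno i hi j hj (fun h => by rw [ei, ej, hxy h]) ?_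
      rw [ei, ej, complCode_code]
      -- A path in `F` becomes a path of literal numbers in the stored graph.
      refine Relation.ReflTransGen.lift Lit.code (fun a b hab => ?_) _ _ hr
      exact (hload.edge_iff _ _).2 ⟨a, b, hL.listImplies hab, rfl, rfl⟩
  · obtain ⟨t, s', h1, h2, h3⟩ := walk_runs rfl hTL hL hF.1 hM hW hload hfound
    have hb : (Test.eq (.reg 0) (.const 1)).Holds s := by simp [hfound.answer]
    exact ⟨_, s', .branch_pos hb h1, by omega, Or.inr h3⟩

/-! ### Time bounds and conclusion -/

theorem unitCount_le_size (F : CNF) : unitCount F ≤ size F := by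
  rw [unitCount, size, Finset.card_eq_sum_ones]
  refine (Finset.sum_le_sum fun C hC => (Finset.mem_filter.1 hC).2.ge).trans ?_
  exact Finset.sum_le_sum_of_subset (Finset.filter_subset _ _)

theorem card_le_size {F : CNF} (hF : IsTwoCNF F) : F.card ≤ size F := by
  rw [size, Finset.card_eq_sum_ones]
  refine Finset.sum_le_sum fun C hC => Finset.card_pos.2 ?_
  exact Finset.nonempty_iff_ne_empty.2 fun e => hF.2.2 (e ▸ hC)

/-- If an MUS with the property exists, its units and the path between them lie in `F`, so a
negative outcome is impossible; for `c = 10` the single unit-clause forces `x = y`. -/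
theorem findsMUSInTime {Q : CNF → Prop} {T : CNF → ℕ} {c : ℕ} (hc : c = 10 ∨ c = 17)
    (hQ : ∀ F', Q F' ↔ 1 ≤ unitCount F' ∧ (c = 10 → unitCount F' = 1))
    (hT : ∀ F, (unitCount F + 1) * (size F + 1) ≤ 4 * timeTerm T F) : FindsMUSInTime Q T := by
  obtain ⟨A, hA⟩ := algorithmCost_le c
  refine ⟨findMUS c, 4 * A, 8, fun F hF L hL => ?_⟩
  obtain ⟨t, s, hrun, ht, hs⟩ := findMUS_runs hF hL hc
  have hlen : L.length ≤ size F := by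
    refine le_trans ?_ (card_le_size hF)
    rw [← hL.2.2, List.toFinset_card_of_nodup hL.2.1, List.length_map]
  have ht : t ≤ 4 * A * timeTerm T F := by
    refine ht.trans ((hA _ _ _ (size F) hlen (by omega) (unitCount_le_size F)).trans ?_)
    calc A * ((unitCount F + 1) * (size F + 1)) ≤ A * (4 * timeTerm T F) :=
          Nat.mul_le_mul_left _ (hT F)
      _ = _ := by ring
  refine ⟨t, s, hrun, ht, ?_, ?_⟩
  · rintro ⟨F', hmus, hq⟩
    rcases hs with ⟨-, hno⟩ | ⟨h0, F'', L', h1, h2, h3, h4, h5⟩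
    · exfalso
      rw [hQ] at hq
      obtain ⟨x, y, hx, hy, hr⟩ := exists_units_reaches (hF.mono hmus.1) hmus.2 hq.1
      exact hno x y (hmus.1 hx) (hmus.1 hy) (fun h => unit_unique (hq.2 h) hx hy)
        (Relation.ReflTransGen.mono (fun _ _ h => h.mono hmus.1) _ _ hr)
    · exact ⟨h0, F'', L', h1, (hQ _).2 ⟨h2, h3⟩, h4, h5⟩
  · intro hno
    rcases hs with ⟨h0, -⟩ | ⟨-, F'', L', h1, h2, h3, h4, h5⟩
    · exact h0
    · exact absurd ⟨F'', h1, (hQ _).2 ⟨h2, h3⟩⟩ hno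

/-- Without unit-clauses the linear reading of the bound applies; otherwise `u + 1 ≤ 2 * u` and `ℓ +
1 ≤ 2 * ℓ`. -/
theorem le_timeTerm_mul (F : CNF) : (unitCount F + 1) * (size F + 1) ≤
    4 * timeTerm (fun F => unitCount F * size F) F := by
  have hu := unitCount_le_size F
  rw [timeTerm]
  split_ifs with h
  · have : unitCount F = 0 := by
      rcases Nat.mul_eq_zero.1 h with h | h <;> omega
    rw [this]
    omega
  · have h1 : 1 ≤ unitCount F := Nat.pos_of_ne_zero fun e => h (by rw [e, Nat.zero_mul])
    nlinarith

theorem le_timeTerm_sq (F : CNF) : (unitCount F + 1) * (size F + 1) ≤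
    4 * timeTerm (fun F => size F ^ 2) F := by
  have hu := unitCount_le_size F
  rw [timeTerm]
  split_ifs with h
  · have hs : size F = 0 := pow_eq_zero_iff (two_ne_zero) |>.1 h
    have : unitCount F = 0 := by omega
    rw [this, hs]
    omega
  · have h1 : 1 ≤ size F := Nat.pos_of_ne_zero fun e => h (by rw [e]; rfl)
    nlinarith

end TwoCNF

theorem corollary6p6 :
    (∀ F F' : TwoCNF.CNF, TwoCNF.IsTwoCNF F → TwoCNF.IsMUS F' F →
      ((1 ≤ TwoCNF.unitCount F' ↔ TwoCNF.FamilyI F' ∨ TwoCNF.FamilyII F') ∧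
       (TwoCNF.unitCount F' = 1 ↔ TwoCNF.FamilyII F'))) ∧
    TwoCNF.FindsMUSInTime (fun F' => 1 ≤ TwoCNF.unitCount F')
      (fun F => TwoCNF.unitCount F * TwoCNF.size F) ∧
    TwoCNF.FindsMUSInTime (fun F' => 1 ≤ TwoCNF.unitCount F')
      (fun F => TwoCNF.size F ^ 2) ∧
    TwoCNF.FindsMUSInTime (fun F' => TwoCNF.unitCount F' = 1)
      (fun F => TwoCNF.unitCount F * TwoCNF.size F) ∧
    TwoCNF.FindsMUSInTime (fun F' => TwoCNF.unitCount F' = 1)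
      (fun F => TwoCNF.size F ^ 2) := by
  refine ⟨fun F F' hF h => TwoCNF.unit_characterization (hF.mono h.1) h.2,
    TwoCNF.findsMUSInTime (c := 17) (Or.inr rfl) (by simp) TwoCNF.le_timeTerm_mul,
    TwoCNF.findsMUSInTime (c := 17) (Or.inr rfl) (by simp) TwoCNF.le_timeTerm_sq,
    TwoCNF.findsMUSInTime (c := 10) (Or.inl rfl) (fun F' => ?_) TwoCNF.le_timeTerm_mul,
    TwoCNF.findsMUSInTime (c := 10) (Or.inl rfl) (fun F' => ?_) TwoCNF.le_timeTerm_sq⟩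
  all_goals exact ⟨fun h => ⟨h.ge, fun _ => h⟩, fun h => h.2 rfl⟩
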